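/- Fix $0<\rho<1$. Let $\{\omega_z : z\in\mathbb Z_{\ge 0}^2\setminus\{0\}\}$ be independent weights under $\mathbb P^\rho$ with $\omega_z\sim\mathrm{Exp}(1)$ for $z\in\mathbb Z_{>0}^2$, $\omega_{ke_1}\sim\mathrm{Exp}(1-\rho)$ and $\omega_{le_2}\sim\mathrm{Exp}(\rho)$ for $k,l\ge 1$ (the parameter of $\mathrm{Exp}$ is the rate), where $e_1=(1,0)$, $e_2=(0,1)$. For $x\le y$ (coordinatewise) in $\mathbb Z_{>0}^2$ let $G_{x,y}$ be the maximum, over nearest-neighbor up-right paths from $x$ to $y$, of the sum of the weights $\omega$ at the vertices of the path, endpoints included. For $z=(m,n)\in\mathbb Z_{>0}^2$ let $$G^\rho_{0,z}=\max_{1\le k\le m}\Bigl\{\sum_{i=1}^k\omega_{ie_1}+G_{ke_1+e_2,z}\Bigr\}\ \vee\ \max_{1\le l\le n}\Bigl\{\sum_{j=1}^l\omega_{je_2}+G_{le_2+e_1,z}\Bigr\},$$ and let the exit time $\tau^{0\to z}\in\mathbb Z\setminus\{0\}$ be the almost surely unique maximizer: $\tau^{0\to z}=k>0$ if the maximum is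 attained by the first term with index $k$, and $\tau^{0\to z}=-l<0$ if it is attained by the second term with index $l$ (in case of a tie, the largest of these integers is taken). Put $v_N=(\lfloor N(1-\rho)^2\rfloor,\lfloor N\rho^2\rfloor)$ and $[\![0,v_N]\!]=\{z\in\mathbb Z^2:0\le z\le v_N\}$. **Theorem.** For each $0<\rho<1$ there exist finite positive constants $\delta_0(\rho)$, $C(\rho)$ and $N_0(\rho)$ such that for all real $N\ge N_0(\rho)$ and all real $\delta$ with $N^{-2/3}\le\delta\le\delta_0(\rho)$, $$\mathbb P^\rho\bigl\{\exists\, z\in\mathbb Z_{>0}^2 \text{ outside } [\![0,v_N]\!] \text{ such that } |\tau^{0\to z}|\le\delta N^{2/3}\bigr\}\ \ge\ C(\rho)\,\delta .$$ -/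

import Mathlib

open MeasureTheory ProbabilityTheory

/-- A nearest-neighbour up-right path from `x` to `y` in the quadrant `ℤ²_{≥0}` (modelled by
`ℕ × ℕ`), given as the list of the vertices that it visits, endpoints included. -/
def IsUpRightPath (x y : ℕ × ℕ) (p : List (ℕ × ℕ)) : Prop :=
  p.head? = some x ∧ p.getLast? = some y ∧
    p.IsChain (fun a b => b = a + (1, 0) ∨ b = a + (0, 1))

/-- The last-passage value `G_{x,y}`: the maximal total weight of an up-right path from `x` to `y`.
It is used only for `x ≤ y`, when the set of paths is finite and nonempty. -/
noncomputable def lastPassage (ω : ℕ × ℕ → ℝ) (x y : ℕ × ℕ) : ℝ :=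
  sSup {s : ℝ | ∃ p : List (ℕ × ℕ), IsUpRightPath x y p ∧ s = (p.map ω).sum}

/-- The marginal distributions of the weights of stationary last-passage percolation based at the
origin: `Exp(1)` in the bulk, `Exp(1-ρ)` on the `e₁`-axis, `Exp(ρ)` on the `e₂`-axis, and no weight
at the origin. -/
noncomputable def stationaryMarginal (ρ : ℝ) (z : ℕ × ℕ) : Measure ℝ :=
  if z.1 = 0 then
    if z.2 = 0 then Measure.dirac 0 else expMeasure ρ
  else
    if z.2 = 0 then expMeasure (1 - ρ) else expMeasure 1

/-- The law `ℙ^ρ` of the independent weights of stationary last-passage percolation. -/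
noncomputable def stationaryMeasure (ρ : ℝ) : Measure (ℕ × ℕ → ℝ) :=
  Measure.infinitePi (stationaryMarginal ρ)

/-- The possible exit times of paths from the origin to a bulk vertex `y = (m, n)`:
`k = 1, …, m` and `k = -1, …, -n`. -/
def exitRange (y : ℕ × ℕ) : Set ℤ :=
  {k : ℤ | (1 ≤ k ∧ k ≤ (y.1 : ℤ)) ∨ (1 ≤ -k ∧ -k ≤ (y.2 : ℤ))}

/-- The maximal weight of the paths from the origin to a bulk vertex `y` with exit time `k`: if
`k > 0` they follow the `e₁`-axis up to `k e₁` and then step to `k e₁ + e₂`; if `k = -l < 0` they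
follow the `e₂`-axis up to `l e₂` and then step to `l e₂ + e₁`. -/
noncomputable def exitValue (ω : ℕ × ℕ → ℝ) (y : ℕ × ℕ) (k : ℤ) : ℝ :=
  if 0 < k then
    ∑ i ∈ Finset.Icc 1 k.toNat, ω (i, 0) + lastPassage ω (k.toNat, 1) y
  else
    ∑ j ∈ Finset.Icc 1 (-k).toNat, ω (0, j) + lastPassage ω (1, (-k).toNat) y

/-- The last-passage value `G^ρ_{0,y}` of the stationary process at a bulk vertex `y`. -/
noncomputable def stationaryLPP (ω : ℕ × ℕ → ℝ) (y : ℕ × ℕ) : ℝ :=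
  sSup (exitValue ω y '' exitRange y)

/-- The exit time `τ^{0 → y}` of the geodesic from the origin to a bulk vertex `y`: the `k` for
which the maximum `G^ρ_{0,y}` is attained by paths with exit time `k`. This `k` is almost surely
unique; on the null event of a tie the largest such `k` is taken. -/
noncomputable def exitTime (ω : ℕ × ℕ → ℝ) (y : ℕ × ℕ) : ℤ :=
  sSup {k : ℤ | k ∈ exitRange y ∧ stationaryLPP ω y = exitValue ω y k}

/-- The lattice point `v_N = (⌊N(1-ρ)²⌋, ⌊Nρ²⌋)` in the characteristic direction. -/
noncomputable def charPoint (ρ N : ℝ) : ℕ × ℕ :=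
  (⌊N * (1 - ρ) ^ 2⌋₊, ⌊N * ρ ^ 2⌋₊)

/-! Small exit times are detected by moving the end point along a horizontal line. Let p(m,n) be the
probability that some maximizing path from the origin to (m,n) starts with an e₁-step. By Burke's
property the process seen from L e₁, with the vertical increments along column L as new boundary
weights, is again stationary with parameter ρ. A maximizing path that leaves the e₁-axis beyond L e₁
still starts horizontally when seen from L e₁. Hence p(m+L,n) ≤ P(0 < τ ≤ L) + p(m,n), which is
`measureReal_verMax_le_horMax_le_add`. Take L = ⌊δN^(2/3)⌋ and n > Nρ², so that every end point on
the line lies outside the box. If p rises from at most 3/8 to at least 5/8 while the end point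
travels a distance of order N^(2/3) across the characteristic direction, then J = O(1/δ) steps of
length L suffice. Every step costs at most the probability of the event in question, so that
probability is at least 1/(4J), which is of order δ.

The bound 3/8 needs no fluctuation theory beyond exponential moments. Let H and V be the maxima over
paths that start horizontally and vertically, and l = m/(1-ρ) + n/ρ the mean of max(H,V). Changing
the rate of the e₁-boundary weights and applying Burke's property with the new parameter gives
explicit bounds on the exponential moments of H, and of V by reflection (`lintegral_exp_horMax_le`,
`lintegral_exp_verMax_le`). If the end point lies left of the characteristic, the quadratic term in
the exponent is negative for H, so H is unlikely to be close to l or above it. On the other hand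
max(H,V) has mean exactly l and an exponential upper tail, so it is unlikely to be far below l.
Together these make H ≥ V unlikely (`measureReal_verMax_le_horMax_le`).

Burke's property comes from one vertex (`lintegral_burke`), is composed up a column
(`measurePreserving_columnShift`), and is linked to last-passage values by `max_horMax_verMax_succ`.
-/

/-! ### Exponential laws and Burke's property at one vertex. -/

lemma lintegral_expMeasure (r : ℝ) (f : ℝ → ENNReal) (hf : Measurable f) :
    ∫⁻ x, f x ∂(expMeasure r) = ∫⁻ x, exponentialPDF r x * f x := by
  have hm : Measurable (exponentialPDF r) := (measurable_exponentialPDFReal r).ennreal_ofReal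
  have : expMeasure r = volume.withDensity (exponentialPDF r) := rfl
  rw [this, lintegral_withDensity_eq_lintegral_mul _ hm hf]
  rfl

lemma exponentialPDF_tilt {r w : ℝ} (hr : 0 < r) (hw : 0 < w) (x : ℝ) :
    exponentialPDF r x
      = exponentialPDF w x * ENNReal.ofReal (r / w * Real.exp ((w - r) * x)) := by
  rcases lt_or_ge x 0 with hx | hx
  · simp [exponentialPDF_of_neg hx]
  · rw [exponentialPDF_of_nonneg hx, exponentialPDF_of_nonneg hx,
      ← ENNReal.ofReal_mul (by positivity)]
    congr 1
    have : -(r * x) = -(w * x) + (w - r) * x := by ring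
    rw [this, Real.exp_add]
    field_simp

lemma expMeasure_tilt {r w : ℝ} (hr : 0 < r) (hw : 0 < w) :
    expMeasure r
      = (expMeasure w).withDensity
          (fun x => ENNReal.ofReal (r / w * Real.exp ((w - r) * x))) := by
  have hm : Measurable (exponentialPDF w) := (measurable_exponentialPDFReal w).ennreal_ofReal
  have h (r : ℝ) : expMeasure r = volume.withDensity (exponentialPDF r) := rfl
  rw [h r, h w, ← withDensity_mul _ hm (by fun_prop)]
  congr 1
  ext x
  exact exponentialPDF_tilt hr hw x

/-- The integrand is a constant multiple of the density of Exp(r - a) with respect to Exp(r), which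
has total mass 1. -/
lemma lintegral_exp_expMeasure {r a : ℝ} (hr : 0 < r) (ha : a < r) :
    ∫⁻ x, ENNReal.ofReal (Real.exp (a * x)) ∂(expMeasure r) = ENNReal.ofReal (r / (r - a)) := by
  have hra : 0 < r - a := by linarith
  have := isProbabilityMeasure_expMeasure hra
  have h1 : ∫⁻ _, 1 ∂(expMeasure (r - a)) = 1 := by simp
  rw [expMeasure_tilt hra hr, lintegral_withDensity_eq_lintegral_mul _ (by fun_prop) (by fun_prop)]
    at h1
  have h2 : ∀ x : ℝ, ENNReal.ofReal (Real.exp (a * x)) = ENNReal.ofReal (r / (r - a)) *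
      ENNReal.ofReal ((r - a) / r * Real.exp ((r - (r - a)) * x)) := by
    intro x
    rw [← ENNReal.ofReal_mul (by positivity)]
    congr 1
    rw [show r - (r - a) = a by ring]
    field_simp
  simp_rw [h2]
  rw [lintegral_const_mul _ (by fun_prop)]
  simp only [Pi.mul_apply, mul_one] at h1
  rw [h1, mul_one]

lemma ae_nonneg_expMeasure (r : ℝ) : ∀ᵐ x ∂(expMeasure r), 0 ≤ x := by
  have hm : Measurable (exponentialPDF r) := (measurable_exponentialPDFReal r).ennreal_ofReal
  have : expMeasure r = volume.withDensity (exponentialPDF r) := rfl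
  rw [this, ae_withDensity_iff hm]
  refine Filter.Eventually.of_forall fun x hx => ?_
  by_contra h
  exact hx (exponentialPDF_of_neg (not_le.1 h))

lemma lintegral_id_expMeasure {r : ℝ} (hr : 0 < r) :
    ∫⁻ x, ENNReal.ofReal x ∂(expMeasure r) = ENNReal.ofReal (1 / r) := by
  rw [lintegral_expMeasure _ _ (by fun_prop)]
  have h0 : ∀ x : ℝ, exponentialPDF r x * ENNReal.ofReal x
      = (Set.Ioi (0 : ℝ)).indicator
        (fun x => ENNReal.ofReal (r * (x ^ ((2 : ℝ) - 1) * Real.exp (-(r * x))))) x := by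
    intro x
    by_cases hx : 0 < x
    · rw [Set.indicator_of_mem (by exact hx), exponentialPDF_of_nonneg hx.le,
        ← ENNReal.ofReal_mul (by positivity)]
      congr 1
      norm_num
      ring
    · rw [Set.indicator_of_notMem (by exact hx), ENNReal.ofReal_of_nonpos (not_lt.1 hx), mul_zero]
  simp_rw [h0]
  rw [lintegral_indicator measurableSet_Ioi,
    ← ofReal_integral_eq_lintegral_ofReal]
  · rw [integral_const_mul, Real.integral_rpow_mul_exp_neg_mul_Ioi (by norm_num) hr]
    congr 1
    rw [Real.Gamma_two]
    norm_num
    field_simp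
  · refine Integrable.const_mul ?_ _
    have := integrableOn_rpow_mul_exp_neg_mul_rpow (s := 1) (p := 1) (b := r) (by norm_num)
      one_pos hr
    refine this.congr_fun (fun x hx => ?_) measurableSet_Ioi
    norm_num
  · filter_upwards [ae_restrict_mem measurableSet_Ioi] with x hx
    have : (0 : ℝ) < x := hx
    positivity

lemma integrable_id_expMeasure {r : ℝ} (hr : 0 < r) :
    Integrable (fun x : ℝ => x) (expMeasure r) := by
  refine ⟨by fun_prop, ?_⟩
  rw [hasFiniteIntegral_iff_ofReal (ae_nonneg_expMeasure r), lintegral_id_expMeasure hr]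
  exact ENNReal.ofReal_lt_top

lemma integral_id_expMeasure {r : ℝ} (hr : 0 < r) :
    ∫ x, x ∂(expMeasure r) = 1 / r := by
  rw [integral_eq_lintegral_of_nonneg_ae (ae_nonneg_expMeasure r) (by fun_prop),
    lintegral_id_expMeasure hr, ENNReal.toReal_ofReal (by positivity)]

/-- Memorylessness at the level of densities: the minimum and the overshoot above it separate. -/
lemma exponentialPDF_add_mul {α β : ℝ} (hα : 0 < α) (hβ : 0 < β) {d : ℝ} (hd : 0 ≤ d) (m : ℝ) :
    exponentialPDF α (m + d) * exponentialPDF β m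
      = ENNReal.ofReal (β / (α + β)) * (exponentialPDF (α + β) m * exponentialPDF α d) := by
  rcases lt_or_ge m 0 with hm | hm
  · simp [exponentialPDF_of_neg hm]
  · rw [exponentialPDF_of_nonneg hm, exponentialPDF_of_nonneg hm, exponentialPDF_of_nonneg hd,
      exponentialPDF_of_nonneg (add_nonneg hm hd), ← ENNReal.ofReal_mul (by positivity),
      ← ENNReal.ofReal_mul (by positivity), ← ENNReal.ofReal_mul (by positivity)]
    congr 1
    have h1 : -(α * (m + d)) = -(α * m) + -(α * d) := by ring
    have h2 : -((α + β) * m) = -(α * m) + -(β * m) := by ring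
    rw [h1, h2, Real.exp_add, Real.exp_add]
    field_simp

/-- The part of the law of two independent exponential variables on which the first is the
larger. -/
lemma lintegral_exponentialPDF_indicator_le {α β : ℝ} (hα : 0 < α) (hβ : 0 < β)
    (f : ℝ → ℝ → ENNReal) (hf : Measurable (Function.uncurry f)) :
    ∫⁻ y, ∫⁻ x, exponentialPDF α x * exponentialPDF β y * (if y ≤ x then f x y else 0)
      = ∫⁻ m, ENNReal.ofReal (β / (α + β)) * ∫⁻ d, f (m + d) m ∂(expMeasure α)
          ∂(expMeasure (α + β)) := by
  have hm (r : ℝ) : Measurable (exponentialPDF r) :=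
    (measurable_exponentialPDFReal r).ennreal_ofReal
  have hf1 : ∀ m, Measurable fun d => f (m + d) m := fun m =>
    hf.comp ((measurable_const.add measurable_id).prodMk measurable_const)
  rw [lintegral_expMeasure]
  · refine lintegral_congr fun m => ?_
    have hg : Measurable fun d => exponentialPDF α d * f (m + d) m := (hm α).mul (hf1 m)
    rw [lintegral_expMeasure _ _ (hf1 m), ← lintegral_const_mul _ hg,
      ← lintegral_const_mul _ (hg.const_mul _), ← lintegral_add_left_eq_self _ m]
    refine lintegral_congr fun d => ?_
    rcases lt_or_ge d 0 with hd | hd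
    · simp [exponentialPDF_of_neg hd, not_le.2 hd]
    · rw [exponentialPDF_add_mul hα hβ hd, if_pos (by linarith)]
      ring
  · refine Measurable.const_mul ?_ _
    have := isProbabilityMeasure_expMeasure hα
    exact Measurable.lintegral_prod_right'
      (f := fun p : ℝ × ℝ => f (p.1 + p.2) p.1) (hf.comp
        (by fun_prop : Measurable fun p : ℝ × ℝ => (p.1 + p.2, p.1)))

/-- The pair of the minimum and the signed difference of two independent exponential variables
with rates `α` and `β`. -/
lemma lintegral_expMeasure_prod_eq {α β : ℝ} (hα : 0 < α) (hβ : 0 < β)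
    (f : ℝ → ℝ → ENNReal) (hf : Measurable (Function.uncurry f)) :
    ∫⁻ x, ∫⁻ y, f x y ∂(expMeasure β) ∂(expMeasure α)
      = ∫⁻ m, ENNReal.ofReal (β / (α + β)) * ∫⁻ d, f (m + d) m ∂(expMeasure α)
          ∂(expMeasure (α + β))
        + ∫⁻ m, ENNReal.ofReal (α / (α + β)) * ∫⁻ d, f m (m + d) ∂(expMeasure β)
          ∂(expMeasure (α + β)) := by
  have hm (r : ℝ) : Measurable (exponentialPDF r) :=
    (measurable_exponentialPDFReal r).ennreal_ofReal
  have hf1 : ∀ x, Measurable fun y => f x y := fun x => hf.comp measurable_prodMk_left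
  have hβp := isProbabilityMeasure_expMeasure hβ
  have h2 := lintegral_exponentialPDF_indicator_le hβ hα (fun x y => f y x)
    (hf.comp measurable_swap)
  rw [add_comm β α] at h2
  rw [← lintegral_exponentialPDF_indicator_le hα hβ f hf, ← h2]
  have hme : Measurable fun p : ℝ × ℝ => exponentialPDF α p.1 * exponentialPDF β p.2 *
      (if p.2 ≤ p.1 then f p.1 p.2 else 0) :=
    (((hm α).comp measurable_fst).mul ((hm β).comp measurable_snd)).mul
      (Measurable.ite (measurableSet_le measurable_snd measurable_fst) hf measurable_const)
  have hF : Measurable fun x => ∫⁻ y, f x y ∂(expMeasure β) := hf.lintegral_prod_right'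
  rw [lintegral_expMeasure _ _ hF, ← lintegral_lintegral_swap hme.aemeasurable,
    ← lintegral_add_left (Measurable.lintegral_prod_right' hme)]
  refine lintegral_congr fun x => ?_
  have hx : Measurable fun y => exponentialPDF α x * exponentialPDF β y *
      (if y ≤ x then f x y else 0) := hme.comp measurable_prodMk_left
  rw [← lintegral_add_left hx, lintegral_expMeasure _ _ (hf1 x),
    ← lintegral_const_mul _ (show Measurable fun y => exponentialPDF β y * f x y from
      (hm β).mul (hf1 x))]
  refine lintegral_congr_ae ?_
  -- Both halves include the diagonal, which is a null set.
  have hne : ∀ᵐ y : ℝ, y ≠ x := by simp [ae_iff]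
  filter_upwards [hne] with y hy
  rcases lt_or_gt_of_ne hy with h | h
  · simp [h.le, not_le.2 h, mul_assoc]
  · simp [h.le, not_le.2 h]
    ring

/-- Burke's theorem for one vertex of stationary last-passage percolation, tested against
functions. -/
lemma lintegral_burke {α β : ℝ} (hα : 0 < α) (hβ : 0 < β)
    (F : ℝ → ℝ → ℝ → ENNReal) (hF : Measurable fun p : ℝ × ℝ × ℝ => F p.1 p.2.1 p.2.2) :
    ∫⁻ w, ∫⁻ x, ∫⁻ y, F (w + max (x - y) 0) (w + max (y - x) 0) (min x y)
        ∂(expMeasure β) ∂(expMeasure α) ∂(expMeasure (α + β))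
      = ∫⁻ w, ∫⁻ x, ∫⁻ y, F x y w
        ∂(expMeasure β) ∂(expMeasure α) ∂(expMeasure (α + β)) := by
  have := isProbabilityMeasure_expMeasure hα
  have := isProbabilityMeasure_expMeasure hβ
  have := isProbabilityMeasure_expMeasure (add_pos hα hβ)
  have h1 : ∀ w, ∫⁻ x, ∫⁻ y, F (w + max (x - y) 0) (w + max (y - x) 0) (min x y)
        ∂(expMeasure β) ∂(expMeasure α)
      = ∫⁻ m, ENNReal.ofReal (β / (α + β)) * ∫⁻ d, F (w + d) w m ∂(expMeasure α)
          ∂(expMeasure (α + β))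
        + ∫⁻ m, ENNReal.ofReal (α / (α + β)) * ∫⁻ d, F w (w + d) m ∂(expMeasure β)
          ∂(expMeasure (α + β)) := by
    intro w
    rw [lintegral_expMeasure_prod_eq hα hβ
      (fun x y => F (w + max (x - y) 0) (w + max (y - x) 0) (min x y)) (hF.comp (by fun_prop :
      Measurable fun p : ℝ × ℝ => (w + max (p.1 - p.2) 0, w + max (p.2 - p.1) 0, min p.1 p.2)))]
    congr 1
    · refine lintegral_congr fun m => ?_
      congr 1
      refine lintegral_congr_ae ?_
      filter_upwards [ae_nonneg_expMeasure α] with d hd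
      simp [hd]
    · refine lintegral_congr fun m => ?_
      congr 1
      refine lintegral_congr_ae ?_
      filter_upwards [ae_nonneg_expMeasure β] with d hd
      simp [hd]
  have h2 : ∀ w, ∫⁻ x, ∫⁻ y, F x y w ∂(expMeasure β) ∂(expMeasure α)
      = ∫⁻ m, ENNReal.ofReal (β / (α + β)) * ∫⁻ d, F (m + d) m w ∂(expMeasure α)
          ∂(expMeasure (α + β))
        + ∫⁻ m, ENNReal.ofReal (α / (α + β)) * ∫⁻ d, F m (m + d) w ∂(expMeasure β)
          ∂(expMeasure (α + β)) := by
    intro w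
    rw [lintegral_expMeasure_prod_eq hα hβ (fun x y => F x y w) (hF.comp (by fun_prop :
      Measurable fun p : ℝ × ℝ => (p.1, p.2, w)))]
  have m1 : Measurable fun p : ℝ × ℝ =>
      ENNReal.ofReal (β / (α + β)) * ∫⁻ d, F (p.1 + d) p.1 p.2 ∂(expMeasure α) :=
    Measurable.const_mul (Measurable.lintegral_prod_right'
      (f := fun q : (ℝ × ℝ) × ℝ => F (q.1.1 + q.2) q.1.1 q.1.2)
      (hF.comp (by fun_prop :
        Measurable fun q : (ℝ × ℝ) × ℝ => (q.1.1 + q.2, q.1.1, q.1.2)))) _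
  have m2 : Measurable fun p : ℝ × ℝ =>
      ENNReal.ofReal (α / (α + β)) * ∫⁻ d, F p.1 (p.1 + d) p.2 ∂(expMeasure β) :=
    Measurable.const_mul (Measurable.lintegral_prod_right'
      (f := fun q : (ℝ × ℝ) × ℝ => F q.1.1 (q.1.1 + q.2) q.1.2)
      (hF.comp (by fun_prop :
        Measurable fun q : (ℝ × ℝ) × ℝ => (q.1.1, q.1.1 + q.2, q.1.2)))) _
  have m1' := m1.comp measurable_swap
  have m2' := m2.comp measurable_swap
  simp only [Function.comp_def, Prod.fst_swap, Prod.snd_swap] at m1' m2'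
  -- The minimum m and the bulk weight w are both Exp(α + β) and independent of the overshoot d. The
  -- two sides now differ only by exchanging m and w.
  simp_rw [h1, h2]
  rw [lintegral_add_left m1'.lintegral_prod_right', lintegral_add_left m1.lintegral_prod_right']
  congr 1
  · exact lintegral_lintegral_swap m1.aemeasurable
  · exact lintegral_lintegral_swap m2.aemeasurable

/-! ### Infinite product measures: resampling, densities, and maps that act locally. -/

section InfiniteProduct

variable {ι : Type*} {X : Type*} [MeasurableSpace X]

lemma measurable_update_prod [DecidableEq ι] (c : ι) :
    Measurable fun p : X × (ι → X) => Function.update p.2 c p.1 := by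
  refine measurable_pi_lambda _ fun i => ?_
  by_cases hi : i = c
  · subst hi; simpa using measurable_fst
  · simp only [Function.update_of_ne hi]; fun_prop

lemma map_update_infinitePi [DecidableEq ι] (μ : ι → Measure X) [∀ i, IsProbabilityMeasure (μ i)]
    (c : ι) :
    ((μ c).prod (Measure.infinitePi μ)).map (fun p : X × (ι → X) => Function.update p.2 c p.1)
      = Measure.infinitePi μ := by
  refine Measure.eq_infinitePi μ fun s t ht => ?_
  have hm := measurable_update_prod (X := X) c
  rw [Measure.map_apply hm (MeasurableSet.pi s.countable_toSet fun i _ => ht i)]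
  have hpre : (fun p : X × (ι → X) => Function.update p.2 c p.1) ⁻¹' (Set.pi s t)
      = (if c ∈ s then t c else Set.univ) ×ˢ Set.pi (s.erase c) t := by
    ext ⟨x, ω⟩
    simp only [Set.mem_preimage, Set.mem_pi, Finset.mem_coe, Set.mem_prod, Finset.mem_erase]
    constructor
    · intro h
      refine ⟨?_, fun i hi => by simpa [hi.1] using h i hi.2⟩
      split_ifs with hc
      · simpa using h c hc
      · trivial
    · rintro ⟨h1, h2⟩ i hi
      by_cases hic : i = c
      · subst hic; simpa [hi] using h1
      · simpa [hic] using h2 i ⟨hic, hi⟩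
  rw [hpre, Measure.prod_prod, Measure.infinitePi_pi μ fun i _ => ht i]
  split_ifs with hc
  · rw [Finset.mul_prod_erase s (fun i => μ i (t i)) hc]
  · rw [measure_univ, one_mul, Finset.erase_eq_of_notMem hc]

lemma lintegral_infinitePi_update [DecidableEq ι] (μ : ι → Measure X)
    [∀ i, IsProbabilityMeasure (μ i)] (c : ι) {F : (ι → X) → ENNReal} (hF : Measurable F) :
    ∫⁻ ω, F ω ∂(Measure.infinitePi μ)
      = ∫⁻ ω, ∫⁻ x, F (Function.update ω c x) ∂(μ c) ∂(Measure.infinitePi μ) := by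
  have hm := measurable_update_prod (X := X) c
  conv_lhs => rw [← map_update_infinitePi μ c]
  exact (lintegral_map hF hm).trans (lintegral_prod_symm' _ (hF.comp hm))

lemma lintegral_infinitePi_finset_prod (μ : ι → Measure X)
    [∀ i, IsProbabilityMeasure (μ i)] (s : Finset ι) {g : ι → X → ENNReal}
    (hg : ∀ i ∈ s, Measurable (g i)) :
    ∫⁻ ω, ∏ i ∈ s, g i (ω i) ∂(Measure.infinitePi μ) = ∏ i ∈ s, ∫⁻ x, g i x ∂(μ i) := by
  classical
  induction s using Finset.induction_on with
  | empty => simp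
  | insert c s hc ih =>
    have hgs : Measurable fun ω : ι → X => ∏ i ∈ s, g i (ω i) :=
      Finset.measurable_fun_prod _ fun i hi =>
        (hg i (Finset.mem_insert_of_mem hi)).comp (measurable_pi_apply i)
    have hgi : Measurable fun ω : ι → X => ∏ i ∈ insert c s, g i (ω i) :=
      Finset.measurable_fun_prod _ fun i hi => (hg i hi).comp (measurable_pi_apply i)
    have hgc := hg c (Finset.mem_insert_self c s)
    rw [Finset.prod_insert hc, ← ih fun i hi => hg i (Finset.mem_insert_of_mem hi),
      lintegral_infinitePi_update μ c hgi, ← lintegral_const_mul _ hgs]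
    refine lintegral_congr fun ω => ?_
    rw [← lintegral_mul_const _ hgc]
    refine lintegral_congr fun x => ?_
    rw [Finset.prod_insert hc, Function.update_self]
    congr 1
    refine Finset.prod_congr rfl fun i hi => ?_
    rw [Function.update_of_ne (by rintro rfl; exact hc hi)]

/-- On a cylinder over `u` the integrand factors over `s ∪ u`. The factors in `s` outside `u`
integrate to 1 because the `ν i` are probability measures. -/
lemma infinitePi_withDensity (μ ν : ι → Measure X) [∀ i, IsProbabilityMeasure (μ i)]
    [∀ i, IsProbabilityMeasure (ν i)] (s : Finset ι) {f : ι → X → ENNReal}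
    (hf : ∀ i ∈ s, Measurable (f i)) (hs : ∀ i ∈ s, ν i = (μ i).withDensity (f i))
    (hs' : ∀ i ∉ s, ν i = μ i) :
    Measure.infinitePi ν = (Measure.infinitePi μ).withDensity fun ω => ∏ i ∈ s, f i (ω i) := by
  classical
  symm
  refine Measure.eq_infinitePi ν fun u t ht => ?_
  have hmu : MeasurableSet (Set.pi (u : Set ι) t) :=
    MeasurableSet.pi u.countable_toSet fun i _ => ht i
  rw [withDensity_apply _ hmu, ← lintegral_indicator hmu]
  have key : ∀ ω : ι → X, (Set.pi (u : Set ι) t).indicator (fun ω => ∏ i ∈ s, f i (ω i)) ω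
      = ∏ i ∈ s ∪ u, (if i ∈ u then (t i).indicator 1 (ω i) else 1)
          * (if i ∈ s then f i (ω i) else 1) := by
    intro ω
    rw [Finset.prod_mul_distrib, Finset.prod_ite_mem, Finset.prod_ite_mem,
      Finset.inter_eq_right.2 Finset.subset_union_right,
      Finset.inter_eq_right.2 Finset.subset_union_left]
    by_cases h : ω ∈ Set.pi (u : Set ι) t
    · have h1 : ∏ i ∈ u, (t i).indicator (1 : X → ENNReal) (ω i) = 1 :=
        Finset.prod_eq_one fun i hi => by rw [Set.indicator_of_mem (h i hi)]; rfl
      rw [Set.indicator_of_mem h, h1, one_mul]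
    · rw [Set.indicator_of_notMem h]
      simp only [Set.mem_pi, not_forall] at h
      obtain ⟨i, hi, hit⟩ := h
      rw [Finset.prod_eq_zero hi (Set.indicator_of_notMem hit _), zero_mul]
  simp_rw [key]
  have hg : ∀ i, Measurable fun x => (if i ∈ u then (t i).indicator (1 : X → ENNReal) x else 1)
      * (if i ∈ s then f i x else 1) := by
    intro i
    refine Measurable.mul ?_ ?_
    · split_ifs
      · exact measurable_one.indicator (ht i)
      · exact measurable_const
    · split_ifs with h
      · exact hf i h
      · exact measurable_const
  rw [lintegral_infinitePi_finset_prod μ (s ∪ u) fun i _ => hg i]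
  have hterm : ∀ i ∈ s ∪ u, ∫⁻ x, (if i ∈ u then (t i).indicator (1 : X → ENNReal) x else 1)
      * (if i ∈ s then f i x else 1) ∂(μ i) = if i ∈ u then ν i (t i) else 1 := by
    intro i _
    by_cases his : i ∈ s
    · have h1 : ν i Set.univ = 1 := measure_univ
      rw [hs i his, withDensity_apply _ .univ, Measure.restrict_univ] at h1
      rw [hs i his, withDensity_apply _ (ht i), ← lintegral_indicator (ht i)]
      by_cases hiu : i ∈ u
      · simp only [hiu, his, if_true]
        refine lintegral_congr fun x => ?_
        by_cases hx : x ∈ t i <;> simp [hx]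
      · simpa [hiu, his] using h1
    · rw [hs' i his]
      by_cases hiu : i ∈ u
      · simp only [hiu, his, if_true, if_false, mul_one]
        rw [lintegral_indicator_one (ht i)]
      · simp [hiu, his]
  rw [Finset.prod_congr rfl hterm, Finset.prod_ite_mem,
    Finset.inter_eq_right.2 Finset.subset_union_right]

/-- The expectation of a function of the coordinates in `K` depends only on the marginals of these
coordinates. -/
lemma lintegral_infinitePi_congr (μ ν : ι → Measure X) [∀ i, IsProbabilityMeasure (μ i)]
    [∀ i, IsProbabilityMeasure (ν i)] (x₀ : X) (K : Set ι) (hK : ∀ i ∈ K, μ i = ν i)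
    {F : (ι → X) → ENNReal} (hF : Measurable F)
    (hFK : ∀ ω ω' : ι → X, (∀ i ∈ K, ω i = ω' i) → F ω = F ω') :
    ∫⁻ ω, F ω ∂(Measure.infinitePi μ) = ∫⁻ ω, F ω ∂(Measure.infinitePi ν) := by
  classical
  -- Freezing the coordinates outside `K` does not change `F` and makes the two families of
  -- marginals equal.
  let g : ι → X → X := fun i x => if i ∈ K then x else x₀
  have hg : ∀ i, Measurable (g i) := by
    intro i
    by_cases hi : i ∈ K
    · simpa [g, hi] using measurable_id'
    · simp [g, hi]
  have hgm : Measurable fun (ω : ι → X) i => g i (ω i) :=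
    measurable_pi_lambda _ fun i => (hg i).comp (measurable_pi_apply i)
  have h (μ : ι → Measure X) [∀ i, IsProbabilityMeasure (μ i)] :
      ∫⁻ ω, F ω ∂(Measure.infinitePi μ)
        = ∫⁻ ω, F ω ∂(Measure.infinitePi fun i => (μ i).map (g i)) := by
    rw [← Measure.infinitePi_map_pi μ hg, lintegral_map hF hgm]
    refine lintegral_congr fun ω => hFK _ _ fun i hi => by simp [g, hi]
  rw [h μ, h ν]
  congr 2
  ext1 i
  by_cases hi : i ∈ K
  · rw [hK i hi]
  · simp [g, hi, Measure.map_const]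

lemma infinitePi_map_comp {κ : Type*} (μ : ι → Measure X) [∀ i, IsProbabilityMeasure (μ i)]
    {e : κ → ι} (he : Function.Injective e) :
    (Measure.infinitePi μ).map (fun ω k => ω (e k)) = Measure.infinitePi fun k => μ (e k) := by
  classical
  refine Measure.eq_infinitePi _ fun s t ht => ?_
  have hm : Measurable fun (ω : ι → X) k => ω (e k) :=
    measurable_pi_lambda _ fun k => measurable_pi_apply (e k)
  rw [Measure.map_apply hm (MeasurableSet.pi s.countable_toSet fun i _ => ht i)]
  have hpre : (fun (ω : ι → X) k => ω (e k)) ⁻¹' (Set.pi s t)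
      = Set.pi (s.image e) (fun i => if h : ∃ k, e k = i then t h.choose else Set.univ) := by
    ext ω
    have hch : ∀ k, (⟨k, rfl⟩ : ∃ k', e k' = e k).choose = k := fun k =>
      he (⟨k, rfl⟩ : ∃ k', e k' = e k).choose_spec
    simp only [Set.mem_preimage, Set.mem_pi, Finset.mem_coe, Finset.mem_image, forall_exists_index,
      and_imp, forall_apply_eq_imp_iff₂]
    refine forall₂_congr fun k _ => ?_
    rw [dif_pos ⟨k, rfl⟩, hch k]
  rw [hpre, Measure.infinitePi_pi, Finset.prod_image he.injOn]
  · refine Finset.prod_congr rfl fun k _ => ?_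
    have hch : (⟨k, rfl⟩ : ∃ k', e k' = e k).choose = k :=
      he (⟨k, rfl⟩ : ∃ k', e k' = e k).choose_spec
    rw [dif_pos ⟨k, rfl⟩, hch]
  · intro i _
    split_ifs
    · exact ht _
    · exact .univ

/-- A map preserves a product measure if on every finite set of coordinates it coincides with a
map that does. -/
lemma measurePreserving_infinitePi_of_local (μ : ι → Measure X)
    [∀ i, IsProbabilityMeasure (μ i)] {T : (ι → X) → (ι → X)} (hT : Measurable T)
    (h : ∀ s : Finset ι, ∃ T' : (ι → X) → (ι → X),
      MeasurePreserving T' (Measure.infinitePi μ) (Measure.infinitePi μ) ∧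
        ∀ ω, ∀ i ∈ s, T ω i = T' ω i) :
    MeasurePreserving T (Measure.infinitePi μ) (Measure.infinitePi μ) := by
  refine ⟨hT, Measure.eq_infinitePi _ fun s t ht => ?_⟩
  have hms : MeasurableSet (Set.pi (s : Set ι) t) :=
    MeasurableSet.pi s.countable_toSet fun i _ => ht i
  obtain ⟨T', hT', hTT'⟩ := h s
  rw [Measure.map_apply hT hms, ← Measure.infinitePi_pi μ fun i _ => ht i,
    ← hT'.measure_preimage hms.nullMeasurableSet]
  congr 1
  ext ω
  simp only [Set.mem_preimage, Set.mem_pi, Finset.mem_coe]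
  exact forall₂_congr fun i hi => by rw [hTT' ω i hi]

/-- Replacing three coordinates by functions of these coordinates preserves a product measure if
it preserves the joint law of the three coordinates. -/
lemma measurePreserving_update₃ [DecidableEq ι] (μ : ι → Measure X)
    [∀ i, IsProbabilityMeasure (μ i)] {a b c : ι} (hab : a ≠ b) (hac : a ≠ c) (hbc : b ≠ c)
    {f g h : X → X → X → X}
    (hf : Measurable fun p : X × X × X => f p.1 p.2.1 p.2.2)
    (hg : Measurable fun p : X × X × X => g p.1 p.2.1 p.2.2)
    (hh : Measurable fun p : X × X × X => h p.1 p.2.1 p.2.2)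
    (H : ∀ F : X → X → X → ENNReal, (Measurable fun p : X × X × X => F p.1 p.2.1 p.2.2) →
      ∫⁻ z, ∫⁻ x, ∫⁻ y, F (f x y z) (g x y z) (h x y z) ∂(μ b) ∂(μ a) ∂(μ c)
        = ∫⁻ z, ∫⁻ x, ∫⁻ y, F x y z ∂(μ b) ∂(μ a) ∂(μ c)) :
    MeasurePreserving (fun ω : ι → X =>
      Function.update (Function.update (Function.update ω a (f (ω a) (ω b) (ω c)))
        b (g (ω a) (ω b) (ω c))) c (h (ω a) (ω b) (ω c)))
      (Measure.infinitePi μ) (Measure.infinitePi μ) := by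
  have hup : Measurable fun p : (X × X × X) × (ι → X) =>
      Function.update (Function.update (Function.update p.2 a p.1.1) b p.1.2.1) c p.1.2.2 := by
    have h1 := (measurable_update_prod (X := X) a).comp
      (by fun_prop : Measurable fun p : (X × X × X) × (ι → X) => (p.1.1, p.2))
    have h2 := (measurable_update_prod (X := X) b).comp
      ((by fun_prop : Measurable fun p : (X × X × X) × (ι → X) => p.1.2.1).prodMk h1)
    exact (measurable_update_prod (X := X) c).comp
      ((by fun_prop : Measurable fun p : (X × X × X) × (ι → X) => p.1.2.2).prodMk h2)
  have hT : Measurable (fun ω : ι → X =>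
      Function.update (Function.update (Function.update ω a (f (ω a) (ω b) (ω c)))
        b (g (ω a) (ω b) (ω c))) c (h (ω a) (ω b) (ω c))) := by
    have hev : Measurable fun ω : ι → X => (ω a, ω b, ω c) := by fun_prop
    exact hup.comp (((hf.comp hev).prodMk ((hg.comp hev).prodMk (hh.comp hev))).prodMk
      measurable_id)
  refine ⟨hT, Measure.ext_of_lintegral _ fun F hF => ?_⟩
  have expand : ∀ G : (ι → X) → ENNReal, Measurable G →
      ∫⁻ ω, G ω ∂(Measure.infinitePi μ)
        = ∫⁻ ω, ∫⁻ z, ∫⁻ x, ∫⁻ y, G (Function.update (Function.update (Function.update ω a x) b y)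
            c z) ∂(μ b) ∂(μ a) ∂(μ c) ∂(Measure.infinitePi μ) := by
    intro G hG
    have hG3 : Measurable fun p : (X × X × X) × (ι → X) =>
      G (Function.update (Function.update (Function.update p.2 a p.1.1) b p.1.2.1) c p.1.2.2) :=
      hG.comp hup
    have m1 : Measurable fun ω => ∫⁻ z, G (Function.update ω c z) ∂(μ c) :=
      (hG.comp ((measurable_update_prod c).comp measurable_swap)).lintegral_prod_right'
    have m2 : Measurable fun ω => ∫⁻ y, ∫⁻ z, G (Function.update (Function.update ω b y) c z)
        ∂(μ c) ∂(μ b) :=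
      (m1.comp ((measurable_update_prod b).comp measurable_swap)).lintegral_prod_right'
    rw [lintegral_infinitePi_update μ c hG, lintegral_infinitePi_update μ b m1,
      lintegral_infinitePi_update μ a m2]
    refine lintegral_congr fun ω => ?_
    have e1 : ∀ x, ∫⁻ y, ∫⁻ z, G (Function.update (Function.update (Function.update ω a x) b y)
        c z) ∂(μ c) ∂(μ b) = ∫⁻ z, ∫⁻ y, G (Function.update (Function.update
          (Function.update ω a x) b y) c z) ∂(μ b) ∂(μ c) := by
      intro x
      refine lintegral_lintegral_swap (Measurable.aemeasurable ?_)
      exact hG3.comp (by fun_prop : Measurable fun p : X × X => ((x, p.1, p.2), ω))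
    simp_rw [e1]
    refine lintegral_lintegral_swap (Measurable.aemeasurable ?_)
    exact Measurable.lintegral_prod_right' (f := fun q : (X × X) × X =>
      G (Function.update (Function.update (Function.update ω a q.1.1) b q.2) c q.1.2))
      (hG3.comp (by fun_prop : Measurable fun q : (X × X) × X => ((q.1.1, q.2, q.1.2), ω)))
  refine (lintegral_map hF hT).trans
    ((expand _ (hF.comp hT)).trans (Eq.trans ?_ (expand F hF).symm))
  refine lintegral_congr fun ω => ?_
  rw [← H fun x y z => F (Function.update (Function.update (Function.update ω a x) b y) c z)]
  · refine lintegral_congr fun z => lintegral_congr fun x => lintegral_congr fun y => ?_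
    simp only [Function.comp_apply]
    congr 1
    ext i
    by_cases hic : i = c
    · subst hic; simp [hac, hbc, hab]
    · by_cases hib : i = b
      · subst hib; simp [hac, hbc, hab]
      · by_cases hia : i = a
        · subst hia; simp [hac, hbc, hab]
        · simp [hia, hib, hic]
  · exact hF.comp (hup.comp (by fun_prop : Measurable fun p : X × X × X => (p, ω)))

end InfiniteProduct

/-! ### Burke's property for a whole column. -/

lemma isProbabilityMeasure_stationaryMarginal {ρ : ℝ} (hρ₀ : 0 < ρ) (hρ₁ : ρ < 1) (z : ℕ × ℕ) :
    IsProbabilityMeasure (stationaryMarginal ρ z) := by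
  unfold stationaryMarginal
  split_ifs
  · infer_instance
  · exact isProbabilityMeasure_expMeasure hρ₀
  · exact isProbabilityMeasure_expMeasure (by linarith)
  · exact isProbabilityMeasure_expMeasure one_pos

lemma isProbabilityMeasure_stationaryMeasure {ρ : ℝ} (hρ₀ : 0 < ρ) (hρ₁ : ρ < 1) :
    IsProbabilityMeasure (stationaryMeasure ρ) := by
  have := isProbabilityMeasure_stationaryMarginal hρ₀ hρ₁
  unfold stationaryMeasure
  infer_instance

/-- The horizontal increment of the stationary last-passage value between the columns `0` and `1`
at height `j`. -/
noncomputable def carry (ω : ℕ × ℕ → ℝ) : ℕ → ℝ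
  | 0 => ω (1, 0)
  | j + 1 => ω (1, j + 1) + max (carry ω j - ω (0, j + 1)) 0

/-- The weights of the stationary process based at `e₁`: the vertical boundary weights are the
vertical increments of the last-passage value along column `1`. -/
noncomputable def columnShift (ω : ℕ × ℕ → ℝ) (z : ℕ × ℕ) : ℝ :=
  if z.1 = 0 then
    if z.2 = 0 then ω (0, 0) else ω (1, z.2) + max (ω (0, z.2) - carry ω (z.2 - 1)) 0
  else ω (z.1 + 1, z.2)

/-- The transformation of the three weights involved in Burke's theorem at the vertex `(1, j)`. -/
noncomputable def vertexStep (j : ℕ) (ω : ℕ × ℕ → ℝ) : ℕ × ℕ → ℝ :=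
  Function.update (Function.update (Function.update ω
    (1, 0) (ω (1, j) + max (ω (1, 0) - ω (0, j)) 0))
    (0, j) (ω (1, j) + max (ω (0, j) - ω (1, 0)) 0))
    (1, j) (min (ω (1, 0)) (ω (0, j)))

/-- The composition of the first `n` vertex steps. -/
noncomputable def vertexSteps : ℕ → (ℕ × ℕ → ℝ) → ℕ × ℕ → ℝ
  | 0 => id
  | n + 1 => vertexStep (n + 1) ∘ vertexSteps n

lemma measurePreserving_vertexStep {ρ : ℝ} (hρ₀ : 0 < ρ) (hρ₁ : ρ < 1) {j : ℕ} (hj : j ≠ 0) :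
    MeasurePreserving (vertexStep j) (stationaryMeasure ρ) (stationaryMeasure ρ) := by
  have := isProbabilityMeasure_stationaryMarginal hρ₀ hρ₁
  refine measurePreserving_update₃ (stationaryMarginal ρ) (a := (1, 0)) (b := (0, j))
    (c := (1, j)) (by simp) (by simp [hj.symm]) (by simp)
    (f := fun x y w => w + max (x - y) 0) (g := fun x y w => w + max (y - x) 0)
    (h := fun x y _ => min x y) (by fun_prop) (by fun_prop) (by fun_prop) fun F hF => ?_
  have h1 : stationaryMarginal ρ (1, 0) = expMeasure (1 - ρ) := by simp [stationaryMarginal]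
  have h2 : stationaryMarginal ρ (0, j) = expMeasure ρ := by simp [stationaryMarginal, hj]
  -- The bulk rate 1 is the sum of the two boundary rates, as Burke's property at a vertex demands.
  have h3 : stationaryMarginal ρ (1, j) = expMeasure (1 - ρ + ρ) := by
    simp [stationaryMarginal, hj]
  rw [h1, h2, h3]
  exact lintegral_burke (by linarith) hρ₀ F hF

lemma measurePreserving_vertexSteps {ρ : ℝ} (hρ₀ : 0 < ρ) (hρ₁ : ρ < 1) (n : ℕ) :
    MeasurePreserving (vertexSteps n) (stationaryMeasure ρ) (stationaryMeasure ρ) := by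
  induction n with
  | zero => exact MeasurePreserving.id _
  | succ n ih => exact (measurePreserving_vertexStep hρ₀ hρ₁ n.succ_ne_zero).comp ih

/-- The coordinate `(1, 0)` transports the horizontal increment upwards, while the coordinates `(0,
j)` are replaced one by one by the increments of column 1. Thus a composition of measure-preserving
steps computes the new boundary. -/
lemma vertexSteps_spec (ω : ℕ × ℕ → ℝ) (n : ℕ) :
    vertexSteps n ω (1, 0) = carry ω n ∧
      (∀ j, n < j → vertexSteps n ω (0, j) = ω (0, j) ∧ vertexSteps n ω (1, j) = ω (1, j)) ∧
      (∀ j, 0 < j → j ≤ n → vertexSteps n ω (0, j) = columnShift ω (0, j)) ∧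
      vertexSteps n ω (0, 0) = ω (0, 0) ∧
      ∀ i j, 2 ≤ i → vertexSteps n ω (i, j) = ω (i, j) := by
  induction n with
  | zero =>
    refine ⟨rfl, fun j _ => ⟨rfl, rfl⟩, fun j h0 h1 => absurd h0 (by omega), rfl,
      fun i j _ => rfl⟩
  | succ n ih =>
    obtain ⟨h1, h2, h3, h4, h5⟩ := ih
    have hn := h2 (n + 1) (Nat.lt_succ_self n)
    refine ⟨?_, fun j hj => ?_, fun j h0 hj => ?_, ?_, fun i j hi => ?_⟩
    · simp [vertexSteps, vertexStep, carry, h1, hn.1, hn.2]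
    · have := h2 j (by omega)
      have hj' : j ≠ n + 1 := by omega
      have hj0 : j ≠ 0 := by omega
      simp [vertexSteps, vertexStep, hj', hj0, this.1, this.2]
    · rcases Nat.lt_or_ge n j with h | h
      · obtain rfl : j = n + 1 := by omega
        simp [vertexSteps, vertexStep, columnShift, h1, hn.1, hn.2]
      · have hj' : j ≠ n + 1 := by omega
        simp [vertexSteps, vertexStep, hj', h3 j h0 h]
    · simp [vertexSteps, vertexStep, h4]
    · have hi0 : i ≠ 0 := by omega
      have hi1 : i ≠ 1 := by omega
      simp [vertexSteps, vertexStep, hi0, hi1, h5 i j hi]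

lemma measurable_carry (j : ℕ) : Measurable fun ω : ℕ × ℕ → ℝ => carry ω j := by
  induction j with
  | zero => exact measurable_pi_apply _
  | succ j ih =>
    exact (measurable_pi_apply _).add ((ih.sub (measurable_pi_apply _)).max measurable_const)

lemma measurable_columnShift : Measurable columnShift := by
  refine measurable_pi_lambda _ fun z => ?_
  unfold columnShift
  split_ifs
  · exact measurable_pi_apply _
  · exact (measurable_pi_apply _).add
      (((measurable_pi_apply _).sub (measurable_carry _)).max measurable_const)
  · exact measurable_pi_apply _

/-- Burke's theorem for a column of stationary last-passage percolation. -/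
theorem measurePreserving_columnShift {ρ : ℝ} (hρ₀ : 0 < ρ) (hρ₁ : ρ < 1) :
    MeasurePreserving columnShift (stationaryMeasure ρ) (stationaryMeasure ρ) := by
  have := isProbabilityMeasure_stationaryMarginal hρ₀ hρ₁
  refine measurePreserving_infinitePi_of_local (stationaryMarginal ρ) measurable_columnShift
    fun s => ?_
  -- Reading coordinates through `e` discards column 1, which after the steps holds the final carry
  -- and the minima. Marginals are unchanged, so the product law survives.
  let e : ℕ × ℕ → ℕ × ℕ := fun z => if z.1 = 0 then z else (z.1 + 1, z.2)
  have he : Function.Injective e := by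
    rintro ⟨i, j⟩ ⟨k, l⟩ h
    simp only [e] at h
    split_ifs at h <;> simp_all
  have hcomp : MeasurePreserving (fun (ω : ℕ × ℕ → ℝ) z => ω (e z))
      (Measure.infinitePi (stationaryMarginal ρ)) (Measure.infinitePi (stationaryMarginal ρ)) := by
    refine ⟨measurable_pi_lambda _ fun z => measurable_pi_apply _, ?_⟩
    rw [infinitePi_map_comp (stationaryMarginal ρ) he]
    congr 1
    ext1 z
    by_cases hz : z.1 = 0 <;> simp [e, stationaryMarginal, hz]
  -- The new boundary weight at height j involves only heights up to j, so finitely many steps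
  -- suffice for the coordinates in `s`.
  let n := s.sup Prod.snd
  refine ⟨fun ω z => vertexSteps n ω (e z),
    hcomp.comp (measurePreserving_vertexSteps hρ₀ hρ₁ n), ?_⟩
  rintro ω ⟨i, j⟩ hz
  have hj : j ≤ n := Finset.le_sup (f := Prod.snd) hz
  obtain ⟨-, -, h3, h4, h5⟩ := vertexSteps_spec ω n
  rcases Nat.eq_zero_or_pos i with rfl | hi
  · rcases Nat.eq_zero_or_pos j with rfl | hj0
    · simp [e, columnShift, h4]
    · simp [e, h3 j hj0 hj]
  · have hi' : i ≠ 0 := hi.ne'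
    simp [e, columnShift, hi', h5 (i + 1) j (by omega)]

/-! ### Last-passage values by recursion, and the exit time. -/

section Deterministic

/-- The weights of the up-right paths from `x` to `y`. -/
def pathWeights (ω : ℕ × ℕ → ℝ) (x y : ℕ × ℕ) : Set ℝ :=
  {s : ℝ | ∃ p : List (ℕ × ℕ), IsUpRightPath x y p ∧ s = (p.map ω).sum}

lemma mem_pathWeights_iff (ω : ℕ × ℕ → ℝ) (x y : ℕ × ℕ) (s : ℝ) :
    s ∈ pathWeights ω x y ↔ (x = y ∧ s = ω x) ∨
      ∃ t, (t ∈ pathWeights ω (x + (1, 0)) y ∨ t ∈ pathWeights ω (x + (0, 1)) y) ∧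
        s = ω x + t := by
  constructor
  · rintro ⟨p, ⟨h1, h2, h3⟩, rfl⟩
    match p with
    | [] => simp at h1
    | [a] =>
      simp only [List.head?_cons, Option.some.injEq, List.getLast?_singleton] at h1 h2
      subst h1
      exact Or.inl ⟨h2, by simp⟩
    | a :: b :: q =>
      simp only [List.head?_cons, Option.some.injEq] at h1
      subst h1
      rw [List.getLast?_cons_cons] at h2
      rw [List.isChain_cons_cons] at h3
      refine Or.inr ⟨((b :: q).map ω).sum, ?_, by simp⟩
      rcases h3.1 with rfl | rfl
      · exact Or.inl ⟨_, ⟨rfl, h2, h3.2⟩, rfl⟩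
      · exact Or.inr ⟨_, ⟨rfl, h2, h3.2⟩, rfl⟩
  · have cons : ∀ b : ℕ × ℕ, (b = x + (1, 0) ∨ b = x + (0, 1)) → ∀ t ∈ pathWeights ω b y,
        ω x + t ∈ pathWeights ω x y := by
      rintro b hb t ⟨p, ⟨h1, h2, h3⟩, rfl⟩
      match p with
      | [] => simp at h1
      | a :: q =>
        simp only [List.head?_cons, Option.some.injEq] at h1
        subst h1
        exact ⟨x :: a :: q, ⟨rfl, by rw [List.getLast?_cons_cons]; exact h2,
          List.isChain_cons_cons.2 ⟨hb, h3⟩⟩, by simp⟩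
    rintro (⟨rfl, rfl⟩ | ⟨t, ht | ht, rfl⟩)
    · exact ⟨[x], ⟨rfl, rfl, List.isChain_singleton _⟩, by simp⟩
    · exact cons _ (Or.inl rfl) t ht
    · exact cons _ (Or.inr rfl) t ht

lemma le_of_mem_pathWeights {ω : ℕ × ℕ → ℝ} {x y : ℕ × ℕ} {s : ℝ} (h : s ∈ pathWeights ω x y) :
    x ≤ y := by
  obtain ⟨p, ⟨h1, h2, h3⟩, -⟩ := h
  induction p generalizing x with
  | nil => simp at h1
  | cons a q ih =>
    simp only [List.head?_cons, Option.some.injEq] at h1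
    subst h1
    match q with
    | [] => simp at h2; exact h2.le
    | b :: q =>
      rw [List.getLast?_cons_cons] at h2
      rw [List.isChain_cons_cons] at h3
      refine le_trans ?_ (ih rfl h2 h3.2)
      rcases h3.1 with rfl | rfl <;> simp

/-- The last-passage value from `x` to `x + (a, b)`, defined by recursion. -/
noncomputable def lpp (ω : ℕ × ℕ → ℝ) : ℕ → ℕ → ℕ × ℕ → ℝ
  | 0, 0, x => ω x
  | a + 1, 0, x => ω x + lpp ω a 0 (x + (1, 0))
  | 0, b + 1, x => ω x + lpp ω 0 b (x + (0, 1))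
  | a + 1, b + 1, x => ω x + max (lpp ω a (b + 1) (x + (1, 0))) (lpp ω (a + 1) b (x + (0, 1)))

lemma add_lpp_right_le (ω : ℕ × ℕ → ℝ) (a b : ℕ) (x : ℕ × ℕ) :
    ω x + lpp ω a b (x + (1, 0)) ≤ lpp ω (a + 1) b x := by
  cases b with
  | zero => rw [lpp]
  | succ b => rw [lpp.eq_4]; gcongr; exact le_max_left _ _

lemma add_lpp_up_le (ω : ℕ × ℕ → ℝ) (a b : ℕ) (x : ℕ × ℕ) :
    ω x + lpp ω a b (x + (0, 1)) ≤ lpp ω a (b + 1) x := by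
  cases a with
  | zero => rw [lpp.eq_3]
  | succ a => rw [lpp.eq_4]; gcongr; exact le_max_right _ _

set_option linter.unnecessarySeqFocus false in
lemma isGreatest_lpp (ω : ℕ × ℕ → ℝ) (a b : ℕ) (x : ℕ × ℕ) :
    IsGreatest (pathWeights ω x (x + (a, b))) (lpp ω a b x) := by
  have e1 : ∀ (a b : ℕ) (x : ℕ × ℕ), x + (a + 1, b) = x + (1, 0) + (a, b) := fun a b x => by
    ext <;> simp <;> omega
  have e2 : ∀ (a b : ℕ) (x : ℕ × ℕ), x + (a, b + 1) = x + (0, 1) + (a, b) := fun a b x => by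
    ext <;> simp <;> omega
  have n1 : ∀ (b : ℕ) (x : ℕ × ℕ) t, t ∉ pathWeights ω (x + (1, 0)) (x + (0, b)) :=
    fun b x t h => by
      have := (le_of_mem_pathWeights h).1
      simp at this
  have n2 : ∀ (a : ℕ) (x : ℕ × ℕ) t, t ∉ pathWeights ω (x + (0, 1)) (x + (a, 0)) :=
    fun a x t h => by
      have := (le_of_mem_pathWeights h).2
      simp at this
  induction a, b, x using lpp.induct with
  | case1 x =>
    refine ⟨(mem_pathWeights_iff _ _ _ _).2 (Or.inl ⟨by ext <;> simp, by rw [lpp]⟩), fun s hs => ?_⟩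
    rcases (mem_pathWeights_iff _ _ _ _).1 hs with ⟨-, rfl⟩ | ⟨t, ht | ht, rfl⟩
    · rw [lpp]
    · exact absurd ht (n1 0 x t)
    · exact absurd ht (n2 0 x t)
  | case2 a x ih =>
    rw [← e1] at ih
    rw [lpp]
    refine ⟨(mem_pathWeights_iff _ _ _ _).2 (Or.inr ⟨_, Or.inl ih.1, rfl⟩), fun s hs => ?_⟩
    rcases (mem_pathWeights_iff _ _ _ _).1 hs with ⟨h, -⟩ | ⟨t, ht | ht, rfl⟩
    · simpa using congrArg Prod.fst h
    · gcongr
      exact ih.2 ht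
    · exact absurd ht (n2 _ x t)
  | case3 b x ih =>
    rw [← e2] at ih
    rw [lpp]
    refine ⟨(mem_pathWeights_iff _ _ _ _).2 (Or.inr ⟨_, Or.inr ih.1, rfl⟩), fun s hs => ?_⟩
    rcases (mem_pathWeights_iff _ _ _ _).1 hs with ⟨h, -⟩ | ⟨t, ht | ht, rfl⟩
    · simpa using congrArg Prod.snd h
    · exact absurd ht (n1 _ x t)
    · gcongr
      exact ih.2 ht
  | case4 a b x ih1 ih2 =>
    rw [← e1] at ih1
    rw [← e2] at ih2
    rw [lpp]
    refine ⟨(mem_pathWeights_iff _ _ _ _).2 (Or.inr ⟨_, ?_, rfl⟩), fun s hs => ?_⟩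
    · rcases max_choice (lpp ω a (b + 1) (x + (1, 0))) (lpp ω (a + 1) b (x + (0, 1))) with h | h
      · rw [h]; exact Or.inl ih1.1
      · rw [h]; exact Or.inr ih2.1
    · rcases (mem_pathWeights_iff _ _ _ _).1 hs with ⟨h, -⟩ | ⟨t, ht | ht, rfl⟩
      · simpa using congrArg Prod.fst h
      · gcongr
        exact (ih1.2 ht).trans (le_max_left _ _)
      · gcongr
        exact (ih2.2 ht).trans (le_max_right _ _)

lemma lastPassage_eq_lpp (ω : ℕ × ℕ → ℝ) (a b : ℕ) (x : ℕ × ℕ) :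
    lastPassage ω x (x + (a, b)) = lpp ω a b x :=
  (isGreatest_lpp ω a b x).csSup_eq

lemma lpp_congr {ω ω' : ℕ × ℕ → ℝ} (a b : ℕ) (x : ℕ × ℕ) (h : ∀ z, x ≤ z → ω z = ω' z) :
    lpp ω a b x = lpp ω' a b x := by
  have h1 : x ≤ x + (1, 0) := by simp
  have h2 : x ≤ x + (0, 1) := by simp
  induction a, b, x using lpp.induct with
  | case1 x => rw [lpp, lpp, h x le_rfl]
  | case2 a x ih => rw [lpp, lpp, h x le_rfl, ih (fun z hz => h z (h1.trans hz))] <;> simp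
  | case3 b x ih => rw [lpp, lpp, h x le_rfl, ih (fun z hz => h z (h2.trans hz))] <;> simp
  | case4 a b x ih1 ih2 =>
    rw [lpp, lpp, h x le_rfl, ih1 (fun z hz => h z (h1.trans hz)),
      ih2 (fun z hz => h z (h2.trans hz))] <;> simp

lemma lpp_add_right {ω ω' : ℕ × ℕ → ℝ} (a b : ℕ) (x : ℕ × ℕ)
    (h : ∀ z, x ≤ z → ω' z = ω (z + (1, 0))) :
    lpp ω' a b x = lpp ω a b (x + (1, 0)) := by
  have h1 : x ≤ x + (1, 0) := by simp
  have h2 : x ≤ x + (0, 1) := by simp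
  induction a, b, x using lpp.induct with
  | case1 x => rw [lpp, lpp, h x le_rfl]
  | case2 a x ih => rw [lpp, lpp, h x le_rfl, ih (fun z hz => h z (h1.trans hz))] <;> simp
  | case3 b x ih =>
    rw [lpp, lpp, h x le_rfl, ih (fun z hz => h z (h2.trans hz)), add_right_comm x] <;> simp
  | case4 a b x ih1 ih2 =>
    rw [lpp, lpp, h x le_rfl, ih1 (fun z hz => h z (h1.trans hz)),
      ih2 (fun z hz => h z (h2.trans hz)), add_right_comm x (0, 1)] <;> simp

lemma lpp_swap (ω : ℕ × ℕ → ℝ) (a b : ℕ) (x : ℕ × ℕ) :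
    lpp (ω ∘ Prod.swap) b a x.swap = lpp ω a b x := by
  have e1 : ∀ x : ℕ × ℕ, x.swap + (0, 1) = (x + (1, 0)).swap := fun x => rfl
  have e2 : ∀ x : ℕ × ℕ, x.swap + (1, 0) = (x + (0, 1)).swap := fun x => rfl
  induction a, b, x using lpp.induct with
  | case1 x => rw [lpp, lpp]; simp
  | case2 a x ih => rw [lpp, lpp, e1, ih]; simp
  | case3 b x ih => rw [lpp, lpp, e2, ih]; simp
  | case4 a b x ih1 ih2 => rw [lpp, lpp, e1, e2, ih1, ih2, max_comm]; simp

lemma measurable_lpp (a b : ℕ) (x : ℕ × ℕ) : Measurable fun ω : ℕ × ℕ → ℝ => lpp ω a b x := by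
  induction a, b, x using lpp.induct with
  | case1 x => simp only [lpp]; exact measurable_pi_apply x
  | case2 a x ih => simp only [lpp]; exact (measurable_pi_apply x).add ih
  | case3 b x ih => simp only [lpp]; exact (measurable_pi_apply x).add ih
  | case4 a b x ih1 ih2 => simp only [lpp]; exact (measurable_pi_apply x).add (ih1.max ih2)

/-- The maximal weight of the paths from the origin to `(m, n)` that leave the `e₁`-axis at
`k e₁`. -/
noncomputable def horExit (ω : ℕ × ℕ → ℝ) (m n k : ℕ) : ℝ :=
  ∑ i ∈ Finset.Icc 1 k, ω (i, 0) + lpp ω (m - k) (n - 1) (k, 1)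

/-- The maximal weight of the paths from the origin to `(m, n)` that begin with an `e₁`-step. -/
noncomputable def horMax (ω : ℕ × ℕ → ℝ) (m n : ℕ) : ℝ :=
  if h : (Finset.Icc 1 m).Nonempty then (Finset.Icc 1 m).sup' h (horExit ω m n) else 0

/-- The maximal weight of the paths from the origin to `(m, n)` that leave the `e₂`-axis at
`l e₂`. -/
noncomputable def verExit (ω : ℕ × ℕ → ℝ) (m n l : ℕ) : ℝ :=
  horExit (ω ∘ Prod.swap) n m l

/-- The maximal weight of the paths from the origin to `(m, n)` that begin with an `e₂`-step. -/
noncomputable def verMax (ω : ℕ × ℕ → ℝ) (m n : ℕ) : ℝ :=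
  horMax (ω ∘ Prod.swap) n m

lemma verExit_eq (ω : ℕ × ℕ → ℝ) (m n l : ℕ) :
    verExit ω m n l = ∑ j ∈ Finset.Icc 1 l, ω (0, j) + lpp ω (m - 1) (n - l) (1, l) := by
  rw [verExit, horExit, ← lpp_swap ω]
  rfl

lemma horExit_le_horMax (ω : ℕ × ℕ → ℝ) {m k : ℕ} (n : ℕ) (hk : 1 ≤ k) (hkm : k ≤ m) :
    horExit ω m n k ≤ horMax ω m n := by
  have h : k ∈ Finset.Icc 1 m := Finset.mem_Icc.2 ⟨hk, hkm⟩
  rw [horMax, dif_pos ⟨k, h⟩]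
  exact Finset.le_sup' (horExit ω m n) h

lemma exists_horExit_eq_horMax (ω : ℕ × ℕ → ℝ) {m : ℕ} (n : ℕ) (hm : 1 ≤ m) :
    ∃ k, 1 ≤ k ∧ k ≤ m ∧ horExit ω m n k = horMax ω m n := by
  have h : (Finset.Icc 1 m).Nonempty := ⟨1, Finset.mem_Icc.2 ⟨le_rfl, hm⟩⟩
  obtain ⟨k, hk, hk'⟩ := Finset.exists_mem_eq_sup' h (horExit ω m n)
  rw [Finset.mem_Icc] at hk
  exact ⟨k, hk.1, hk.2, by rw [horMax, dif_pos h, hk']⟩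

lemma horMax_le_iff (ω : ℕ × ℕ → ℝ) {m : ℕ} (n : ℕ) (hm : 1 ≤ m) (c : ℝ) :
    horMax ω m n ≤ c ↔ ∀ k, 1 ≤ k → k ≤ m → horExit ω m n k ≤ c := by
  refine ⟨fun h k h1 h2 => (horExit_le_horMax ω n h1 h2).trans h, fun h => ?_⟩
  obtain ⟨k, h1, h2, h3⟩ := exists_horExit_eq_horMax ω n hm
  exact h3 ▸ h k h1 h2

lemma verMax_le_iff (ω : ℕ × ℕ → ℝ) (m : ℕ) {n : ℕ} (hn : 1 ≤ n) (c : ℝ) :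
    verMax ω m n ≤ c ↔ ∀ l, 1 ≤ l → l ≤ n → verExit ω m n l ≤ c :=
  horMax_le_iff _ m hn c

lemma measurable_horExit (m n k : ℕ) : Measurable fun ω : ℕ × ℕ → ℝ => horExit ω m n k := by
  have h : Measurable fun ω : ℕ × ℕ → ℝ => ∑ i ∈ Finset.Icc 1 k, ω (i, 0) :=
    Finset.measurable_fun_sum _ fun i _ => measurable_pi_apply (i, 0)
  exact h.add (measurable_lpp _ _ _)

lemma measurable_horMax (m n : ℕ) : Measurable fun ω : ℕ × ℕ → ℝ => horMax ω m n := by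
  unfold horMax
  split_ifs with h
  · have : (fun ω : ℕ × ℕ → ℝ => (Finset.Icc 1 m).sup' h (horExit ω m n))
        = (Finset.Icc 1 m).sup' h fun k ω => horExit ω m n k := by
      ext ω
      rw [Finset.sup'_apply]
    rw [this]
    exact Finset.measurable_sup' h fun k _ => measurable_horExit m n k
  · exact measurable_const

lemma measurable_comp_swap : Measurable fun ω : ℕ × ℕ → ℝ => ω ∘ Prod.swap :=
  measurable_pi_lambda _ fun _ => measurable_pi_apply _

lemma measurable_verMax (m n : ℕ) : Measurable fun ω : ℕ × ℕ → ℝ => verMax ω m n :=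
  (measurable_horMax n m).comp measurable_comp_swap

lemma exitValue_natCast (ω : ℕ × ℕ → ℝ) {m n k : ℕ} (hk : 1 ≤ k) (hkm : k ≤ m) (hn : 1 ≤ n) :
    exitValue ω (m, n) k = horExit ω m n k := by
  have e : ((m, n) : ℕ × ℕ) = (k, 1) + (m - k, n - 1) := by ext <;> simp <;> omega
  rw [exitValue, if_pos (by omega), Int.toNat_natCast, horExit, e, lastPassage_eq_lpp]

lemma exitValue_neg_natCast (ω : ℕ × ℕ → ℝ) {m n l : ℕ} (hln : l ≤ n) (hm : 1 ≤ m) :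
    exitValue ω (m, n) (-l) = verExit ω m n l := by
  have e : ((m, n) : ℕ × ℕ) = (1, l) + (m - 1, n - l) := by ext <;> simp <;> omega
  rw [exitValue, if_neg (by omega), neg_neg, Int.toNat_natCast, verExit_eq, e, lastPassage_eq_lpp]

lemma mem_exitRange_iff {m n : ℕ} {k : ℤ} :
    k ∈ exitRange (m, n) ↔ (∃ i : ℕ, 1 ≤ i ∧ i ≤ m ∧ k = i) ∨
      ∃ l : ℕ, 1 ≤ l ∧ l ≤ n ∧ k = -(l : ℤ) := by
  simp only [exitRange, Set.mem_ofPred_eq]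
  constructor
  · rintro (⟨h1, h2⟩ | ⟨h1, h2⟩)
    · exact Or.inl ⟨k.toNat, by omega, by omega, by omega⟩
    · exact Or.inr ⟨(-k).toNat, by omega, by omega, by omega⟩
  · rintro (⟨i, h1, h2, rfl⟩ | ⟨l, h1, h2, rfl⟩)
    · exact Or.inl ⟨by omega, by omega⟩
    · exact Or.inr ⟨by omega, by omega⟩

lemma stationaryLPP_eq_max (ω : ℕ × ℕ → ℝ) {m n : ℕ} (hm : 1 ≤ m) (hn : 1 ≤ n) :
    stationaryLPP ω (m, n) = max (horMax ω m n) (verMax ω m n) := by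
  refine IsGreatest.csSup_eq ⟨?_, ?_⟩
  · rcases max_choice (horMax ω m n) (verMax ω m n) with h | h
    · obtain ⟨k, h1, h2, h3⟩ := exists_horExit_eq_horMax ω n hm
      exact ⟨k, mem_exitRange_iff.2 (Or.inl ⟨k, h1, h2, rfl⟩), by
        rw [h, ← h3, exitValue_natCast ω h1 h2 hn]⟩
    · obtain ⟨k, h1, h2, h3⟩ := exists_horExit_eq_horMax (ω ∘ Prod.swap) m hn
      exact ⟨-k, mem_exitRange_iff.2 (Or.inr ⟨k, h1, h2, rfl⟩), by
        rw [h, verMax, ← h3, exitValue_neg_natCast ω h2 hm, verExit]⟩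
  · rintro _ ⟨k, hk, rfl⟩
    rcases mem_exitRange_iff.1 hk with ⟨i, h1, h2, rfl⟩ | ⟨l, h1, h2, rfl⟩
    · rw [exitValue_natCast ω h1 h2 hn]
      exact (horExit_le_horMax ω n h1 h2).trans (le_max_left _ _)
    · rw [exitValue_neg_natCast ω h2 hm]
      exact (horExit_le_horMax _ m h1 h2).trans (le_max_right _ _)

/-- The exit time is at least any horizontal exit point of a path of maximal weight, and if it is
positive then it is such a point. -/
lemma exitTime_spec (ω : ℕ × ℕ → ℝ) {m n : ℕ} (hm : 1 ≤ m) (hn : 1 ≤ n)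
    (h : verMax ω m n ≤ horMax ω m n) :
    ∃ k : ℕ, 1 ≤ k ∧ k ≤ m ∧ exitTime ω (m, n) = k ∧ horExit ω m n k = horMax ω m n := by
  set S := {k : ℤ | k ∈ exitRange (m, n) ∧ stationaryLPP ω (m, n) = exitValue ω (m, n) k}
  have hG : stationaryLPP ω (m, n) = horMax ω m n := by
    rw [stationaryLPP_eq_max ω hm hn, max_eq_left h]
  obtain ⟨k, h1, h2, h3⟩ := exists_horExit_eq_horMax ω n hm
  have hkS : (k : ℤ) ∈ S := ⟨mem_exitRange_iff.2 (Or.inl ⟨k, h1, h2, rfl⟩), by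
    rw [hG, ← h3, exitValue_natCast ω h1 h2 hn]⟩
  have hbdd : BddAbove S := ⟨m, fun j hj => by
    rcases mem_exitRange_iff.1 hj.1 with ⟨i, _, _, rfl⟩ | ⟨l, _, _, rfl⟩ <;> omega⟩
  have hmem : exitTime ω (m, n) ∈ S := Int.csSup_mem ⟨k, hkS⟩ hbdd
  have hle : (k : ℤ) ≤ exitTime ω (m, n) := le_csSup hbdd hkS
  rcases mem_exitRange_iff.1 hmem.1 with ⟨i, hi1, hi2, hi⟩ | ⟨l, _, _, hl⟩
  · refine ⟨i, hi1, hi2, hi, ?_⟩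
    rw [← hG, hmem.2, hi, exitValue_natCast ω hi1 hi2 hn]
  · omega

end Deterministic

/-! ### How last-passage values transform when the origin moves to e₁. -/

section Shift

/-- The stationary last-passage value along column `1`, at height `l`. -/
noncomputable def colSum (ω : ℕ × ℕ → ℝ) (l : ℕ) : ℝ :=
  ω (1, 0) + ∑ j ∈ Finset.Icc 1 l, columnShift ω (0, j)

lemma columnShift_zero_succ (ω : ℕ × ℕ → ℝ) (l : ℕ) :
    columnShift ω (0, l + 1) = ω (1, l + 1) + max (ω (0, l + 1) - carry ω l) 0 := by
  simp [columnShift]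

lemma columnShift_succ (ω : ℕ × ℕ → ℝ) (i j : ℕ) :
    columnShift ω (i + 1, j) = ω (i + 2, j) := by
  simp [columnShift]

/-- Increments around the strip between columns 0 and 1 telescope: right and then up gives the same
total as up and then right. -/
lemma colSum_eq_add_carry (ω : ℕ × ℕ → ℝ) (l : ℕ) :
    colSum ω l = ∑ j ∈ Finset.Icc 1 l, ω (0, j) + carry ω l := by
  induction l with
  | zero => simp [colSum, carry]
  | succ l ih =>
    have h1 : colSum ω (l + 1) = colSum ω l + columnShift ω (0, l + 1) := by
      rw [colSum, colSum, Finset.sum_Icc_succ_top (by omega), add_assoc]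
    rw [h1, ih, columnShift_zero_succ, carry, Finset.sum_Icc_succ_top (by omega)]
    rcases le_total (carry ω l) (ω (0, l + 1)) with h | h
    · rw [max_eq_left (by linarith), max_eq_right (by linarith)]; ring
    · rw [max_eq_right (by linarith), max_eq_left (by linarith)]; ring

lemma colSum_succ (ω : ℕ × ℕ → ℝ) (l : ℕ) :
    colSum ω (l + 1)
      = max (colSum ω l) (∑ j ∈ Finset.Icc 1 (l + 1), ω (0, j)) + ω (1, l + 1) := by
  rw [colSum_eq_add_carry, colSum_eq_add_carry, carry, Finset.sum_Icc_succ_top (by omega)]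
  rcases le_total (carry ω l) (ω (0, l + 1)) with h | h
  · rw [max_eq_right (by linarith), max_eq_right (by linarith)]; ring
  · rw [max_eq_left (by linarith), max_eq_left (by linarith)]; ring

/-- The maximum on the left is the value of the best path to `(1, l + 1)` without its last weight.
By induction, entering `(1, l + 1)` from below continues a path already counted at the previous
height, and entering from the left is a vertical exit. -/
lemma max_colSum_add_lpp_le (ω : ℕ × ℕ → ℝ) (m n l : ℕ) (hl : l + 1 ≤ n) :
    max (colSum ω l) (∑ j ∈ Finset.Icc 1 (l + 1), ω (0, j)) + lpp ω m (n - (l + 1)) (1, l + 1)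
      ≤ max (horMax ω (m + 1) n) (verMax ω (m + 1) n) := by
  have hv : ∀ l, 1 ≤ l → l ≤ n → ∑ j ∈ Finset.Icc 1 l, ω (0, j) + lpp ω m (n - l) (1, l)
      ≤ max (horMax ω (m + 1) n) (verMax ω (m + 1) n) := fun l h1 h2 => by
    have := horExit_le_horMax (ω ∘ Prod.swap) (m + 1) h1 h2
    rw [← verExit, verExit_eq] at this
    exact this.trans (le_max_right _ _)
  induction l with
  | zero =>
    rw [max_add]
    refine max_le ?_ (hv 1 le_rfl hl)
    have := horExit_le_horMax ω n (le_refl 1) (Nat.succ_le_succ (Nat.zero_le m))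
    refine le_trans (le_of_eq ?_) (this.trans (le_max_left _ _))
    simp [colSum, horExit]
  | succ l ih =>
    rw [max_add]
    refine max_le ?_ (hv _ (by omega) hl)
    refine le_trans ?_ (ih (by omega))
    rw [colSum_succ, add_assoc]
    gcongr
    obtain ⟨d, rfl⟩ : ∃ d, n = l + 1 + 1 + d := ⟨_, (Nat.add_sub_cancel' hl).symm⟩
    have := add_lpp_up_le ω m d (1, l + 1)
    rw [show l + 1 + 1 + d - (l + 1 + 1) = d by omega,
      show l + 1 + 1 + d - (l + 1) = d + 1 by omega]
    exact this

lemma max_colSum_add_lpp_zero_le (ω : ℕ × ℕ → ℝ) (d l : ℕ) :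
    max (colSum ω l) (∑ j ∈ Finset.Icc 1 (l + 1), ω (0, j)) + lpp ω 0 d (1, l + 1)
      ≤ colSum ω (l + 1 + d) := by
  induction d generalizing l with
  | zero => rw [lpp, add_zero, colSum_succ]
  | succ d ih =>
    rw [lpp.eq_3, ← add_assoc, ← colSum_succ]
    have := ih (l + 1)
    rw [show l + 1 + 1 + d = l + 1 + (d + 1) by ring] at this
    refine le_trans ?_ this
    gcongr
    · exact le_max_left _ _
    · exact le_rfl

/-- Every path that reaches column 2 crosses from column 1 at some height, and `hc` bounds the
crossing at each height. The induction is on the height `d` that remains. -/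
lemma max_colSum_add_lpp_succ_le (ω : ℕ × ℕ → ℝ) (m n : ℕ) (c : ℝ)
    (hc : ∀ l, 1 ≤ l → l ≤ n → colSum ω l + lpp ω m (n - l) (2, l) ≤ c) (d l : ℕ)
    (hl : l + 1 + d = n) :
    max (colSum ω l) (∑ j ∈ Finset.Icc 1 (l + 1), ω (0, j)) + lpp ω (m + 1) d (1, l + 1) ≤ c := by
  have h1 := hc (l + 1) (by omega) (by omega)
  rw [show n - (l + 1) = d by omega] at h1
  induction d generalizing l with
  | zero =>
    rw [lpp, ← add_assoc, ← colSum_succ]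
    exact h1
  | succ d ih =>
    rw [lpp.eq_4, ← add_assoc, ← colSum_succ, add_max]
    refine max_le h1 ?_
    have h2 := hc (l + 2) (by omega) (by omega)
    rw [show n - (l + 2) = d by omega] at h2
    refine le_trans ?_ (ih (l + 1) (by omega) h2)
    gcongr
    · exact le_max_left _ _
    · exact le_rfl

lemma add_verExit_columnShift (ω : ℕ × ℕ → ℝ) (m n l : ℕ) :
    ω (1, 0) + verExit (columnShift ω) (m + 1) n l = colSum ω l + lpp ω m (n - l) (2, l) := by
  rw [verExit_eq, ← add_assoc, ← colSum]
  congr 1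
  refine lpp_add_right _ _ _ fun z hz => ?_
  have : z.1 ≠ 0 := by have := hz.1; simp at this; omega
  rw [columnShift, if_neg this]
  rfl

lemma add_horExit_columnShift (ω : ℕ × ℕ → ℝ) (m n : ℕ) {k : ℕ} (hk : 1 ≤ k) :
    ω (1, 0) + horExit (columnShift ω) m n k = horExit ω (m + 1) n (k + 1) := by
  rw [horExit, horExit, ← add_assoc, Nat.add_sub_add_right]
  congr 1
  · induction k, hk using Nat.le_induction with
    | base => simp [Finset.sum_Icc_succ_top, columnShift]
    | succ k hk ih =>
      rw [Finset.sum_Icc_succ_top (by omega), ← add_assoc, ih,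
        Finset.sum_Icc_succ_top (by omega : 1 ≤ k + 1 + 1), columnShift_succ]
  · refine lpp_add_right _ _ _ fun z hz => ?_
    have : z.1 ≠ 0 := by have := hz.1; simp at this; omega
    rw [columnShift, if_neg this]
    rfl

lemma max_horMax_verMax_one (ω : ℕ × ℕ → ℝ) {n : ℕ} (hn : 1 ≤ n) :
    max (horMax ω 1 n) (verMax ω 1 n) = colSum ω n := by
  obtain ⟨n, rfl⟩ : ∃ n', n = n' + 1 := ⟨n - 1, by omega⟩
  refine le_antisymm (max_le ?_ ?_) ?_
  · rw [horMax_le_iff _ _ le_rfl]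
    intro k h1 h2
    obtain rfl : k = 1 := by omega
    have := max_colSum_add_lpp_zero_le ω n 0
    rw [zero_add, add_comm 1 n] at this
    refine le_trans ?_ this
    rw [horExit]
    gcongr
    · refine le_trans (le_of_eq ?_) (le_max_left _ _)
      simp [colSum]
    · exact le_rfl
  · rw [verMax_le_iff _ _ (by omega)]
    intro l h1 h2
    obtain ⟨l, rfl⟩ : ∃ l', l = l' + 1 := ⟨l - 1, by omega⟩
    have := max_colSum_add_lpp_zero_le ω (n - l) l
    rw [show l + 1 + (n - l) = n + 1 by omega] at this
    refine le_trans ?_ this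
    rw [verExit_eq, Nat.add_sub_add_right]
    gcongr
    · exact le_max_right _ _
  · have := max_colSum_add_lpp_le ω 0 (n + 1) n le_rfl
    rw [Nat.sub_self, lpp, ← colSum_succ] at this
    exact this

/-- Paths are sorted by where they enter column 2. Entry at height l ≥ 1 becomes a vertical exit at
l for the shifted weights, because the best way to `(1, l)` has value `colSum ω l`. Entry along the
axis becomes a horizontal exit with index lowered by one. -/
lemma max_horMax_verMax_succ (ω : ℕ × ℕ → ℝ) {m n : ℕ} (hm : 1 ≤ m) (hn : 1 ≤ n) :
    max (horMax ω (m + 1) n) (verMax ω (m + 1) n)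
      = ω (1, 0) + max (horMax (columnShift ω) m n) (verMax (columnShift ω) m n) := by
  obtain ⟨m, rfl⟩ : ∃ m', m = m' + 1 := ⟨m - 1, by omega⟩
  have hc : ∀ l, 1 ≤ l → l ≤ n → colSum ω l + lpp ω m (n - l) (2, l) ≤ ω (1, 0) +
      max (horMax (columnShift ω) (m + 1) n) (verMax (columnShift ω) (m + 1) n) := by
    intro l h1 h2
    rw [← add_verExit_columnShift]
    gcongr
    exact (horExit_le_horMax _ _ h1 h2).trans (le_max_right _ _)
  refine le_antisymm (max_le ?_ ?_) ?_
  · rw [horMax_le_iff _ _ (by omega)]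
    intro k h1 h2
    rcases Nat.eq_or_lt_of_le h1 with rfl | h1
    · refine le_trans ?_ (max_colSum_add_lpp_succ_le ω m n _ hc (n - 1) 0 (by omega))
      rw [horExit]
      gcongr
      · refine le_trans (le_of_eq ?_) (le_max_left _ _)
        simp [colSum]
      · exact le_rfl
    · obtain ⟨k, rfl⟩ : ∃ k', k = k' + 1 := ⟨k - 1, by omega⟩
      rw [← add_horExit_columnShift ω _ _ (by omega)]
      gcongr
      exact (horExit_le_horMax _ _ (by omega) (by omega)).trans (le_max_left _ _)
  · rw [verMax_le_iff _ _ (by omega)]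
    intro l h1 h2
    obtain ⟨l, rfl⟩ : ∃ l', l = l' + 1 := ⟨l - 1, by omega⟩
    refine le_trans ?_ (max_colSum_add_lpp_succ_le ω m n _ hc (n - (l + 1)) l (by omega))
    rw [verExit_eq]
    gcongr
    · exact le_max_right _ _
    · exact le_rfl
  · rw [add_max]
    refine max_le ?_ ?_
    · obtain ⟨k, h1, h2, h3⟩ := exists_horExit_eq_horMax (columnShift ω) n hm
      rw [← h3, add_horExit_columnShift ω _ _ h1]
      exact (horExit_le_horMax _ _ (by omega) (by omega)).trans (le_max_left _ _)
    · obtain ⟨l, h1, h2, h3⟩ := exists_horExit_eq_horMax (columnShift ω ∘ Prod.swap) (m + 1) hn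
      rw [verMax, ← h3, ← verExit, add_verExit_columnShift]
      obtain ⟨l, rfl⟩ : ∃ l', l = l' + 1 := ⟨l - 1, by omega⟩
      refine le_trans ?_ (max_colSum_add_lpp_le ω (m + 1) n l h2)
      rw [colSum_succ, add_assoc]
      gcongr
      exact add_lpp_right_le ω m _ (1, l + 1)

/-- The stationary last-passage value is the sum of the increments along the south and the east
sides of the rectangle. -/
lemma max_horMax_verMax_eq_sum (ω : ℕ × ℕ → ℝ) {m n : ℕ} (hm : 1 ≤ m) (hn : 1 ≤ n) :
    max (horMax ω m n) (verMax ω m n)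
      = ∑ i ∈ Finset.Icc 1 m, ω (i, 0) + ∑ j ∈ Finset.Icc 1 n, (columnShift^[m] ω) (0, j) := by
  induction m, hm using Nat.le_induction generalizing ω with
  | base => rw [max_horMax_verMax_one ω hn, colSum]; simp
  | succ m hm ih =>
    rw [max_horMax_verMax_succ ω hm hn, ih, ← add_assoc, Function.iterate_succ_apply]
    congr 1
    clear ih
    induction m, hm using Nat.le_induction with
    | base => simp [Finset.sum_Icc_succ_top, columnShift]
    | succ m hm ih =>
      rw [Finset.sum_Icc_succ_top (by omega), ← add_assoc, ih,
        Finset.sum_Icc_succ_top (by omega : 1 ≤ m + 1 + 1), columnShift_succ]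

/-- Each shift removes the same weight `ω (1, 0)` from the optimum and from the path with exit `k`,
and lowers that exit by one. As `L < k`, the path stays optimal with a positive exit through all `L`
shifts. -/
lemma verMax_le_horMax_iterate_columnShift (ω : ℕ × ℕ → ℝ) {m n k : ℕ} (L : ℕ) (hn : 1 ≤ n)
    (hk : L < k) (hkm : k ≤ m)
    (h : horExit ω m n k = max (horMax ω m n) (verMax ω m n)) :
    verMax (columnShift^[L] ω) (m - L) n ≤ horMax (columnShift^[L] ω) (m - L) n := by
  induction L generalizing ω m k with
  | zero =>
    refine (le_max_right _ _).trans (h.symm.le.trans ?_)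
    exact horExit_le_horMax ω n hk hkm
  | succ L ih =>
    obtain ⟨m, rfl⟩ : ∃ m', m = m' + 1 := ⟨m - 1, by omega⟩
    obtain ⟨k, rfl⟩ : ∃ k', k = k' + 1 := ⟨k - 1, by omega⟩
    rw [Function.iterate_succ_apply, Nat.add_sub_add_right]
    refine ih _ (k := k) (by omega) (by omega) ?_
    rw [max_horMax_verMax_succ ω (by omega) hn, ← add_horExit_columnShift ω _ _ (by omega)] at h
    linarith

end Shift

/-! ### Exponential moments and the mean of the stationary process. -/

section Probability

lemma map_comp_swap_stationaryMeasure {ρ : ℝ} (hρ₀ : 0 < ρ) (hρ₁ : ρ < 1) :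
    (stationaryMeasure ρ).map (fun ω => ω ∘ Prod.swap) = stationaryMeasure (1 - ρ) := by
  have := isProbabilityMeasure_stationaryMarginal hρ₀ hρ₁
  refine (infinitePi_map_comp (stationaryMarginal ρ) Prod.swap_injective).trans ?_
  rw [stationaryMeasure]
  congr 1
  ext1 z
  by_cases h1 : z.1 = 0 <;> by_cases h2 : z.2 = 0 <;> simp [stationaryMarginal, h1, h2]

lemma horExit_congr {ω ω' : ℕ × ℕ → ℝ} {m : ℕ} (n : ℕ) {k : ℕ} (hk : 1 ≤ k) (hkm : k ≤ m)
    (h : ∀ z : ℕ × ℕ, 1 ≤ z.1 → (z.2 = 0 → z.1 ≤ m) → ω z = ω' z) :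
    horExit ω m n k = horExit ω' m n k := by
  rw [horExit, horExit]
  congr 1
  · refine Finset.sum_congr rfl fun i hi => ?_
    rw [Finset.mem_Icc] at hi
    exact h _ hi.1 fun _ => hi.2.trans hkm
  · refine lpp_congr _ _ _ fun z hz => h z (hk.trans hz.1) fun h0 => ?_
    have := hz.2
    simp [h0] at this

lemma horMax_congr {ω ω' : ℕ × ℕ → ℝ} (m n : ℕ)
    (h : ∀ z : ℕ × ℕ, 1 ≤ z.1 → (z.2 = 0 → z.1 ≤ m) → ω z = ω' z) :
    horMax ω m n = horMax ω' m n := by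
  unfold horMax
  split_ifs with hm
  · refine Finset.sup'_congr hm rfl fun k hk => ?_
    rw [Finset.mem_Icc] at hk
    exact horExit_congr n hk.1 hk.2 h
  · rfl

lemma lintegral_exp_sum_vertical {ρ a : ℝ} (hρ₀ : 0 < ρ) (hρ₁ : ρ < 1) (ha : a < ρ) (n : ℕ) :
    ∫⁻ ω, ENNReal.ofReal (Real.exp (a * ∑ j ∈ Finset.Icc 1 n, ω (0, j))) ∂(stationaryMeasure ρ)
      = ENNReal.ofReal ((ρ / (ρ - a)) ^ n) := by
  have := isProbabilityMeasure_stationaryMarginal hρ₀ hρ₁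
  have hra : 0 < ρ - a := by linarith
  have hinj : Set.InjOn (fun j : ℕ => ((0, j) : ℕ × ℕ)) (Finset.Icc 1 n) :=
    fun i _ j _ h => (Prod.mk.inj h).2
  have key : ∀ ω : ℕ × ℕ → ℝ,
      ENNReal.ofReal (Real.exp (a * ∑ j ∈ Finset.Icc 1 n, ω (0, j)))
        = ∏ z ∈ (Finset.Icc 1 n).image fun j : ℕ => ((0, j) : ℕ × ℕ),
            ENNReal.ofReal (Real.exp (a * ω z)) := by
    intro ω
    rw [Finset.prod_image hinj, Finset.mul_sum, Real.exp_sum,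
      ENNReal.ofReal_prod_of_nonneg fun _ _ => (Real.exp_pos _).le]
  simp_rw [key]
  rw [stationaryMeasure, lintegral_infinitePi_finset_prod (stationaryMarginal ρ) _
    (g := fun _ x => ENNReal.ofReal (Real.exp (a * x))) (fun _ _ => by fun_prop),
    Finset.prod_image hinj, Finset.prod_congr rfl (g := fun _ => ENNReal.ofReal (ρ / (ρ - a)))]
  · rw [Finset.prod_const, Nat.card_Icc, Nat.add_sub_cancel, ENNReal.ofReal_pow (by positivity)]
  · intro j hj
    rw [Finset.mem_Icc] at hj
    have h2 : stationaryMarginal ρ (0, j) = expMeasure ρ := by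
      simp [stationaryMarginal]; omega
    rw [h2, lintegral_exp_expMeasure hρ₀ ha]

/-- Exponential moments of the last-passage value over the paths that begin with an `e₁`-step. -/
lemma lintegral_exp_horMax_le {ρ a : ℝ} (hρ₀ : 0 < ρ) (hρ₁ : ρ < 1) (ha₀ : 0 ≤ a)
    (ha : a < 1 - ρ) {m n : ℕ} (hm : 1 ≤ m) (hn : 1 ≤ n) :
    ∫⁻ ω, ENNReal.ofReal (Real.exp (a * horMax ω m n)) ∂(stationaryMeasure ρ)
      ≤ ENNReal.ofReal (((1 - ρ) / (1 - ρ - a)) ^ m * ((ρ + a) / ρ) ^ n) := by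
  classical
  -- With parameter `w` the density of Exp(1-ρ) against Exp(1-w) on the e₁-axis contributes
  -- exp(-aω), exactly cancelling the boundary weights in exp(a max(H,V)).
  set w := ρ + a with hw
  have hw₀ : 0 < w := by linarith
  have hw₁ : w < 1 := by linarith
  have := isProbabilityMeasure_stationaryMarginal hρ₀ hρ₁
  have := isProbabilityMeasure_stationaryMarginal hw₀ hw₁
  have hα : 0 < 1 - ρ := by linarith
  have hα' : 0 < 1 - w := by linarith
  set s : Finset (ℕ × ℕ) := (Finset.Icc 1 m).image fun i : ℕ => ((i, 0) : ℕ × ℕ) with hs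
  have hinj : Set.InjOn (fun i : ℕ => ((i, 0) : ℕ × ℕ)) (Finset.Icc 1 m) :=
    fun i _ j _ h => (Prod.mk.inj h).1
  have mem_s : ∀ z : ℕ × ℕ, z ∈ s ↔ 1 ≤ z.1 ∧ z.1 ≤ m ∧ z.2 = 0 := by
    rintro ⟨i, j⟩
    simp only [hs, Finset.mem_image, Finset.mem_Icc, Prod.mk.injEq]
    constructor
    · rintro ⟨i', ⟨h1, h2⟩, rfl, rfl⟩; exact ⟨h1, h2, rfl⟩
    · rintro ⟨h1, h2, h3⟩; exact ⟨i, ⟨h1, h2⟩, rfl, h3.symm⟩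
  let f : ℝ → ENNReal := fun x =>
    ENNReal.ofReal ((1 - ρ) / (1 - w) * Real.exp ((1 - w - (1 - ρ)) * x))
  let ν : ℕ × ℕ → Measure ℝ := fun z =>
    if z ∈ s then expMeasure (1 - ρ) else stationaryMarginal w z
  have hνp : ∀ z, IsProbabilityMeasure (ν z) := by
    intro z
    by_cases hz : z ∈ s
    · simp only [ν, hz, if_true]; exact isProbabilityMeasure_expMeasure hα
    · simp only [ν, hz, if_false]; infer_instance
  have hmeas : Measurable fun ω : ℕ × ℕ → ℝ => ENNReal.ofReal (Real.exp (a * horMax ω m n)) :=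
    ((measurable_horMax m n).const_mul a).exp.ennreal_ofReal
  -- Paths that start horizontally never see the e₂-axis, so the weights there may be given the
  -- parameter `w`; so may the e₁-axis beyond m.
  have step1 : ∫⁻ ω, ENNReal.ofReal (Real.exp (a * horMax ω m n)) ∂(stationaryMeasure ρ)
      = ∫⁻ ω, ENNReal.ofReal (Real.exp (a * horMax ω m n)) ∂(Measure.infinitePi ν) := by
    refine lintegral_infinitePi_congr (stationaryMarginal ρ) ν 0
      {z | 1 ≤ z.1 ∧ (z.2 = 0 → z.1 ≤ m)} ?_ hmeas ?_
    · rintro z ⟨h1, h2⟩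
      have h1' : z.1 ≠ 0 := by omega
      by_cases h3 : z.2 = 0
      · have : z ∈ s := (mem_s z).2 ⟨h1, h2 h3, h3⟩
        simp [ν, this, stationaryMarginal, h1', h3]
      · have : z ∉ s := fun h => h3 ((mem_s z).1 h).2.2
        simp [ν, this, stationaryMarginal, h1', h3]
    · intro ω ω' h
      rw [horMax_congr m n fun z h1 h2 => h z ⟨h1, h2⟩]
  have step2 : Measure.infinitePi ν
      = (stationaryMeasure w).withDensity fun ω => ∏ z ∈ s, f (ω z) := by
    refine infinitePi_withDensity (stationaryMarginal w) ν s (f := fun _ => f)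
      (fun _ _ => by fun_prop) ?_ ?_
    · intro z hz
      have hz' := (mem_s z).1 hz
      have h1 : z.1 ≠ 0 := by omega
      simp only [ν, hz, if_true, stationaryMarginal, h1, hz'.2.2, if_false]
      exact expMeasure_tilt hα hα'
    · intro z hz
      simp [ν, hz]
  have hfm : Measurable fun ω : ℕ × ℕ → ℝ => ∏ z ∈ s, f (ω z) :=
    Finset.measurable_fun_prod _ fun z _ =>
      (by fun_prop : Measurable f).comp (measurable_pi_apply z)
  have prod_f : ∀ ω : ℕ × ℕ → ℝ, ∏ z ∈ s, f (ω z) = ENNReal.ofReal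
      (((1 - ρ) / (1 - w)) ^ m * Real.exp (-(a * ∑ i ∈ Finset.Icc 1 m, ω (i, 0)))) := by
    intro ω
    rw [hs, Finset.prod_image hinj, ← ENNReal.ofReal_prod_of_nonneg
      fun _ _ => by positivity, Finset.prod_mul_distrib, Finset.prod_const, Nat.card_Icc,
      Nat.add_sub_cancel, ← Real.exp_sum, ← Finset.mul_sum]
    congr 3
    rw [hw]; ring
  rw [step1, step2, lintegral_withDensity_eq_lintegral_mul _ hfm hmeas]
  have hT := (measurePreserving_columnShift hw₀ hw₁).iterate m
  calc ∫⁻ ω : ℕ × ℕ → ℝ, ((fun ω : ℕ × ℕ → ℝ => ∏ z ∈ s, f (ω z)) * fun ω =>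
          ENNReal.ofReal (Real.exp (a * horMax ω m n))) ω ∂(stationaryMeasure w)
      ≤ ∫⁻ ω, ENNReal.ofReal (((1 - ρ) / (1 - w)) ^ m) * ENNReal.ofReal (Real.exp
          (a * ∑ j ∈ Finset.Icc 1 n, (columnShift^[m] ω) (0, j))) ∂(stationaryMeasure w) := by
        refine lintegral_mono fun ω => ?_
        simp only [Pi.mul_apply]
        rw [prod_f, ← ENNReal.ofReal_mul (by positivity), ← ENNReal.ofReal_mul (by positivity),
          mul_assoc, ← Real.exp_add]
        refine ENNReal.ofReal_le_ofReal ?_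
        gcongr
        -- The only loss is the passage from H to max(H,V); the south side then cancels and the east
        -- side has independent Exp(w) increments.
        have h1 := le_max_left (horMax ω m n) (verMax ω m n)
        rw [max_horMax_verMax_eq_sum ω hm hn] at h1
        nlinarith
    _ = ENNReal.ofReal (((1 - ρ) / (1 - w)) ^ m) * ∫⁻ ω, ENNReal.ofReal (Real.exp
          (a * ∑ j ∈ Finset.Icc 1 n, ω (0, j))) ∂(stationaryMeasure w) := by
        have hg : Measurable fun ω : ℕ × ℕ → ℝ =>
            ENNReal.ofReal (Real.exp (a * ∑ j ∈ Finset.Icc 1 n, ω (0, j))) := by fun_prop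
        rw [← hT.lintegral_comp hg, lintegral_const_mul]
        exact hg.comp hT.measurable
    _ = ENNReal.ofReal (((1 - ρ) / (1 - ρ - a)) ^ m * (w / ρ) ^ n) := by
        rw [lintegral_exp_sum_vertical hw₀ hw₁ (by linarith), ← ENNReal.ofReal_mul (by positivity)]
        rw [show 1 - w = 1 - ρ - a by rw [hw]; ring, show w - a = ρ by rw [hw]; ring]

/-- Reflection in the diagonal exchanges ρ with 1 - ρ and m with n. -/
lemma lintegral_exp_verMax_le {ρ a : ℝ} (hρ₀ : 0 < ρ) (hρ₁ : ρ < 1) (ha₀ : 0 ≤ a)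
    (ha : a < ρ) {m n : ℕ} (hm : 1 ≤ m) (hn : 1 ≤ n) :
    ∫⁻ ω, ENNReal.ofReal (Real.exp (a * verMax ω m n)) ∂(stationaryMeasure ρ)
      ≤ ENNReal.ofReal ((ρ / (ρ - a)) ^ n * ((1 - ρ + a) / (1 - ρ)) ^ m) := by
  have h := lintegral_exp_horMax_le (ρ := 1 - ρ) (a := a) (by linarith) (by linarith) ha₀
    (by linarith) hn hm
  rw [← map_comp_swap_stationaryMeasure hρ₀ hρ₁, lintegral_map
    ((measurable_horMax n m).const_mul a).exp.ennreal_ofReal measurable_comp_swap,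
    show 1 - (1 - ρ) = ρ by ring] at h
  exact h

lemma integrable_weight {ρ : ℝ} (hρ₀ : 0 < ρ) (hρ₁ : ρ < 1) {z : ℕ × ℕ} {r : ℝ} (hr : 0 < r)
    (hz : stationaryMarginal ρ z = expMeasure r) :
    Integrable (fun ω : ℕ × ℕ → ℝ => ω z) (stationaryMeasure ρ) ∧
      ∫ ω, ω z ∂(stationaryMeasure ρ) = 1 / r := by
  have := isProbabilityMeasure_stationaryMarginal hρ₀ hρ₁
  have hmp : MeasurePreserving (Function.eval z) (stationaryMeasure ρ) (expMeasure r) :=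
    hz ▸ measurePreserving_eval_infinitePi (stationaryMarginal ρ) z
  refine ⟨hmp.integrable_comp_of_integrable (integrable_id_expMeasure hr), ?_⟩
  rw [← integral_id_expMeasure hr, ← hmp.map_eq, integral_map hmp.aemeasurable (by fun_prop)]

/-- The mean of the stationary last-passage value. -/
lemma integral_max_horMax_verMax {ρ : ℝ} (hρ₀ : 0 < ρ) (hρ₁ : ρ < 1) {m n : ℕ} (hm : 1 ≤ m)
    (hn : 1 ≤ n) :
    Integrable (fun ω => max (horMax ω m n) (verMax ω m n)) (stationaryMeasure ρ) ∧
      ∫ ω, max (horMax ω m n) (verMax ω m n) ∂(stationaryMeasure ρ)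
        = m / (1 - ρ) + n / ρ := by
  have hT := (measurePreserving_columnShift hρ₀ hρ₁).iterate m
  have hor : ∀ i ∈ Finset.Icc 1 m, stationaryMarginal ρ (i, 0) = expMeasure (1 - ρ) := by
    intro i hi
    rw [Finset.mem_Icc] at hi
    simp [stationaryMarginal]; omega
  have ver : ∀ j ∈ Finset.Icc 1 n, stationaryMarginal ρ (0, j) = expMeasure ρ := by
    intro i hi
    rw [Finset.mem_Icc] at hi
    simp [stationaryMarginal]; omega
  have hI := fun i hi => integrable_weight hρ₀ hρ₁ (by linarith : 0 < 1 - ρ) (hor i hi)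
  have hJ := fun j hj => integrable_weight hρ₀ hρ₁ hρ₀ (ver j hj)
  have hJ1 : ∀ j ∈ Finset.Icc 1 n, Integrable (fun ω => (columnShift^[m] ω) (0, j))
      (stationaryMeasure ρ) := fun j hj => hT.integrable_comp_of_integrable (hJ j hj).1
  have hJ2 : ∀ j ∈ Finset.Icc 1 n, ∫ ω, (columnShift^[m] ω) (0, j) ∂(stationaryMeasure ρ)
      = 1 / ρ := by
    intro j hj
    rw [← (hJ j hj).2]
    conv_rhs => rw [← hT.map_eq]
    rw [integral_map hT.aemeasurable (measurable_pi_apply _).aestronglyMeasurable]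
  simp_rw [fun ω => max_horMax_verMax_eq_sum ω hm hn]
  have s1 := integrable_finsetSum _ fun i hi => (hI i hi).1
  have s2 := integrable_finsetSum _ hJ1
  refine ⟨s1.add s2, ?_⟩
  rw [integral_add s1 s2, integral_finsetSum _ fun i hi => (hI i hi).1,
    integral_finsetSum _ hJ1, Finset.sum_congr rfl fun i hi => (hI i hi).2,
    Finset.sum_congr rfl hJ2]
  simp [div_eq_mul_inv]

end Probability

/-! ### Probability of a horizontal start on either side of the characteristic, and telescoping. -/

section Estimates

/-- Second-order Taylor expansion of the logarithms with cubic remainder. The linear term is `a`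
times the stationary mean, and the sign of the quadratic term tells the side of the characteristic
direction. -/
lemma exp_moment_le {α β a : ℝ} (hα : 0 < α) (hβ : 0 < β) (ha : 0 ≤ a) (haα : a ≤ α / 2)
    (haβ : a ≤ β / 2) (m n : ℕ) :
    (α / (α - a)) ^ m * ((β + a) / β) ^ n
      ≤ Real.exp (a * (m / α + n / β)
          + (-(a ^ 2 * (n / β ^ 2 - m / α ^ 2) / 2) + 2 * a ^ 3 * (m / α ^ 3 + n / β ^ 3))) := by
  have log_le : ∀ x : ℝ, |x| ≤ 1 / 2 → |x + x ^ 2 / 2 + Real.log (1 - x)| ≤ 2 * |x| ^ 3 := by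
    intro x hx
    have h := Real.abs_log_sub_add_sum_range_le (x := x) (by linarith) 2
    simp only [Finset.sum_range_succ, Finset.sum_range_zero] at h
    norm_num at h
    refine h.trans ?_
    rw [div_le_iff₀ (by linarith)]
    have : 0 ≤ |x| ^ 3 := by positivity
    have := mul_le_mul_of_nonneg_left hx this
    linarith
  have h1 : α / (α - a) ≤ Real.exp (a / α + (a / α) ^ 2 / 2 + 2 * (a / α) ^ 3) := by
    have hx : |a / α| = a / α := abs_of_nonneg (by positivity)
    have hx2 : a / α ≤ 1 / 2 := by rw [div_le_iff₀ hα]; linarith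
    have h := (abs_le.1 (log_le (a / α) (by rw [hx]; exact hx2))).1
    rw [hx] at h
    have h0 : 0 < 1 - a / α := by linarith
    have e : α / (α - a) = (1 - a / α)⁻¹ := by
      have : α - a ≠ 0 := by linarith
      field_simp
    rw [e, ← Real.exp_log (inv_pos.2 h0), Real.log_inv]
    exact Real.exp_le_exp.2 (by linarith)
  have h2 : (β + a) / β ≤ Real.exp (a / β - (a / β) ^ 2 / 2 + 2 * (a / β) ^ 3) := by
    have hx : |-(a / β)| = a / β := by rw [abs_neg]; exact abs_of_nonneg (by positivity)
    have hx2 : a / β ≤ 1 / 2 := by rw [div_le_iff₀ hβ]; linarith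
    have h := (abs_le.1 (log_le (-(a / β)) (by rw [hx]; exact hx2))).2
    rw [hx, sub_neg_eq_add] at h
    have h0 : 0 < 1 + a / β := by positivity
    have e : (β + a) / β = 1 + a / β := by field_simp
    rw [e, ← Real.exp_log h0]
    exact Real.exp_le_exp.2 (by linarith)
  have hαa : 0 ≤ α / (α - a) := div_nonneg hα.le (by linarith)
  calc (α / (α - a)) ^ m * ((β + a) / β) ^ n
      ≤ Real.exp (a / α + (a / α) ^ 2 / 2 + 2 * (a / α) ^ 3) ^ m
        * Real.exp (a / β - (a / β) ^ 2 / 2 + 2 * (a / β) ^ 3) ^ n := by gcongr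
    _ = _ := by
      rw [← Real.exp_nat_mul, ← Real.exp_nat_mul, ← Real.exp_add]
      congr 1
      field_simp
      ring

/-- Centred exponential moments from exponential moments. -/
lemma integral_exp_sub_le {Ω : Type*} [MeasurableSpace Ω] {μ : Measure Ω} {X : Ω → ℝ}
    (hX : Measurable X) {a l c : ℝ}
    (h : ∫⁻ ω, ENNReal.ofReal (Real.exp (a * X ω)) ∂μ ≤ ENNReal.ofReal (Real.exp (a * l + c))) :
    Integrable (fun ω => Real.exp (a * (X ω - l))) μ ∧
      ∫ ω, Real.exp (a * (X ω - l)) ∂μ ≤ Real.exp c := by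
  have hm : Measurable fun ω => Real.exp (a * X ω) := (hX.const_mul a).exp
  have hi : Integrable (fun ω => Real.exp (a * X ω)) μ := by
    refine ⟨hm.aestronglyMeasurable, ?_⟩
    rw [hasFiniteIntegral_iff_ofReal (Filter.Eventually.of_forall fun _ => (Real.exp_pos _).le)]
    exact h.trans_lt ENNReal.ofReal_lt_top
  have e : ∀ ω, Real.exp (a * (X ω - l)) = Real.exp (-(a * l)) * Real.exp (a * X ω) := fun ω => by
    rw [← Real.exp_add]; congr 1; ring
  simp_rw [e]
  refine ⟨hi.const_mul _, ?_⟩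
  rw [integral_const_mul, integral_eq_lintegral_of_nonneg_ae
    (Filter.Eventually.of_forall fun _ => (Real.exp_pos _).le) hm.aestronglyMeasurable]
  have h3 := ENNReal.toReal_mono ENNReal.ofReal_ne_top h
  rw [ENNReal.toReal_ofReal (Real.exp_pos _).le] at h3
  calc _ ≤ Real.exp (-(a * l)) * Real.exp (a * l + c) := by gcongr
    _ = Real.exp c := by rw [← Real.exp_add]; congr 1; ring

/-- If H wins, then either max(H,V) = H is at least t/a₀ below its mean l, or H exceeds l - t/a₀.
The first summand bounds the former through a lower-tail estimate with the small parameter `a₀`; the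
second bounds the latter by Chernoff's inequality with `a`. -/
lemma measureReal_verMax_le_horMax_le {ρ : ℝ} (hρ₀ : 0 < ρ) (hρ₁ : ρ < 1) {m n : ℕ} (hm : 1 ≤ m)
    (hn : 1 ≤ n) {a a₀ t : ℝ} (ha₀ : 0 < a₀) (haa : a₀ ≤ a) (haρ : a ≤ ρ / 2)
    (haρ' : a ≤ (1 - ρ) / 2) (ht : 0 < t) {d q : ℝ}
    (hd : d = n / ρ ^ 2 - m / (1 - ρ) ^ 2) (hq : q = m / (1 - ρ) ^ 3 + n / ρ ^ 3) :
    (stationaryMeasure ρ).real {ω | verMax ω m n ≤ horMax ω m n}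
      ≤ (Real.exp (-(a₀ ^ 2 * d / 2) + 2 * a₀ ^ 3 * q)
          + Real.exp (a₀ ^ 2 * d / 2 + 2 * a₀ ^ 3 * q)) / t
        + Real.exp (a / a₀ * t + (-(a ^ 2 * d / 2) + 2 * a ^ 3 * q)) := by
  have := isProbabilityMeasure_stationaryMeasure hρ₀ hρ₁
  have hα : 0 < 1 - ρ := by linarith
  have ha : 0 < a := ha₀.trans_le haa
  set μ := stationaryMeasure ρ
  set l : ℝ := m / (1 - ρ) + n / ρ with hl
  set H : (ℕ × ℕ → ℝ) → ℝ := fun ω => horMax ω m n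
  set V : (ℕ × ℕ → ℝ) → ℝ := fun ω => verMax ω m n
  have hH : ∀ b, 0 < b → b ≤ a → Integrable (fun ω => Real.exp (b * (H ω - l))) μ ∧
      ∫ ω, Real.exp (b * (H ω - l)) ∂μ ≤ Real.exp (-(b ^ 2 * d / 2) + 2 * b ^ 3 * q) := by
    intro b hb hba
    refine integral_exp_sub_le (measurable_horMax m n)
      ((lintegral_exp_horMax_le hρ₀ hρ₁ hb.le (by linarith) hm hn).trans
        (ENNReal.ofReal_le_ofReal ?_))
    rw [hd, hq]
    exact exp_moment_le hα hρ₀ hb.le (by linarith) (by linarith) m n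
  have hV : ∀ b, 0 < b → b ≤ a → Integrable (fun ω => Real.exp (b * (V ω - l))) μ ∧
      ∫ ω, Real.exp (b * (V ω - l)) ∂μ ≤ Real.exp (b ^ 2 * d / 2 + 2 * b ^ 3 * q) := by
    intro b hb hba
    refine integral_exp_sub_le (measurable_verMax m n)
      ((lintegral_exp_verMax_le hρ₀ hρ₁ hb.le (by linarith) hm hn).trans
        (ENNReal.ofReal_le_ofReal ?_))
    refine (exp_moment_le hρ₀ hα hb.le (by linarith) (by linarith) n m).trans (le_of_eq ?_)
    rw [hd, hq, hl]
    congr 1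
    ring
  obtain ⟨hH₀, hH₀'⟩ := hH a₀ ha₀ haa
  obtain ⟨hV₀, hV₀'⟩ := hV a₀ ha₀ haa
  obtain ⟨hH₁, hH₁'⟩ := hH a ha le_rfl
  obtain ⟨hG, hG'⟩ := integral_max_horMax_verMax hρ₀ hρ₁ hm hn
  -- Nonnegative since x ≤ exp x, and the subtracted term has mean zero. So exponential moments
  -- control the mean of `g`, and Markov's inequality for `g` yields the lower tail of max(H,V).
  set g : (ℕ × ℕ → ℝ) → ℝ := fun ω => Real.exp (a₀ * (H ω - l)) + Real.exp (a₀ * (V ω - l))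
    - a₀ * (max (H ω) (V ω) - l) with hg
  have hGi : Integrable (fun ω => a₀ * (max (H ω) (V ω) - l)) μ :=
    (hG.sub (integrable_const l)).const_mul a₀
  have hGz : ∫ ω, a₀ * (max (H ω) (V ω) - l) ∂μ = 0 := by
    rw [integral_const_mul, integral_sub hG (integrable_const l), hG']
    simp [hl]
  have hgi : Integrable g μ := (hH₀.add hV₀).sub hGi
  have hgle : ∀ ω, a₀ * (max (H ω) (V ω) - l)
      ≤ Real.exp (a₀ * (H ω - l)) + Real.exp (a₀ * (V ω - l)) := by
    intro ω
    have p1 := Real.exp_pos (a₀ * (H ω - l))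
    have p2 := Real.exp_pos (a₀ * (V ω - l))
    rcases max_choice (H ω) (V ω) with h | h <;> rw [h]
    · linarith [Real.add_one_le_exp (a₀ * (H ω - l))]
    · linarith [Real.add_one_le_exp (a₀ * (V ω - l))]
  have hg0 : 0 ≤ g := fun ω => by
    have := hgle ω
    simp only [hg, Pi.zero_apply]
    linarith
  have hgint : ∫ ω, g ω ∂μ ≤ Real.exp (-(a₀ ^ 2 * d / 2) + 2 * a₀ ^ 3 * q)
          + Real.exp (a₀ ^ 2 * d / 2 + 2 * a₀ ^ 3 * q) := by
    have e : ∫ ω, g ω ∂μ = ∫ ω, Real.exp (a₀ * (H ω - l)) ∂μ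
        + ∫ ω, Real.exp (a₀ * (V ω - l)) ∂μ := by
      have hHV : Integrable (fun ω => Real.exp (a₀ * (H ω - l)) + Real.exp (a₀ * (V ω - l))) μ :=
        hH₀.add hV₀
      simp only [hg]
      rw [integral_sub hHV hGi, hGz, sub_zero, integral_add hH₀ hV₀]
    rw [e]
    exact add_le_add hH₀' hV₀'
  have m1 : μ.real {ω | t ≤ g ω} ≤ (Real.exp (-(a₀ ^ 2 * d / 2) + 2 * a₀ ^ 3 * q)
          + Real.exp (a₀ ^ 2 * d / 2 + 2 * a₀ ^ 3 * q)) / t := by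
    rw [le_div_iff₀ ht, mul_comm]
    exact (mul_meas_ge_le_integral_of_nonneg (Filter.Eventually.of_forall hg0) hgi t).trans hgint
  have m2 : μ.real {ω | Real.exp (-(a / a₀ * t)) ≤ Real.exp (a * (H ω - l))}
      ≤ Real.exp (a / a₀ * t + (-(a ^ 2 * d / 2) + 2 * a ^ 3 * q)) := by
    have h := (mul_meas_ge_le_integral_of_nonneg
      (Filter.Eventually.of_forall fun ω => (Real.exp_pos (a * (H ω - l))).le) hH₁
      (Real.exp (-(a / a₀ * t)))).trans hH₁'
    rw [Real.exp_neg, inv_mul_le_iff₀ (Real.exp_pos _), ← Real.exp_add] at h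
    rw [Real.exp_neg]
    exact h
  refine (measureReal_mono ?_).trans ((measureReal_union_le _ _).trans (add_le_add m1 m2))
  intro ω hω
  have hω' : V ω ≤ H ω := hω
  by_cases h : a₀ * (H ω - l) ≤ -t
  · left
    change t ≤ g ω
    have p1 := Real.exp_pos (a₀ * (H ω - l))
    have p2 := Real.exp_pos (a₀ * (V ω - l))
    simp only [hg, max_eq_left hω']
    linarith
  · right
    refine Real.exp_le_exp.2 ?_
    have e : a * (H ω - l) = a / a₀ * (a₀ * (H ω - l)) := by field_simp
    rw [e, ← mul_neg]
    have : 0 ≤ a / a₀ := by positivity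
    exact mul_le_mul_of_nonneg_left (by linarith) this

/-- It is unlikely that the path of maximal weight begins with an `e₁`-step if the end point lies
sufficiently far to the left of the characteristic direction. -/
lemma measureReal_verMax_le_horMax_le_three_eighths {ρ : ℝ} (hρ₀ : 0 < ρ) (hρ₁ : ρ < 1)
    {K q t x : ℝ} (hK : 0 ≤ K) (ht : t = 16 * Real.exp (1 + K)) (hq : q = 2 * t + 2 * (K + 2))
    (hx : 0 < x) (hxρ : x ≤ ρ / 2) (hxρ' : x ≤ (1 - ρ) / 2) {m n : ℕ} (hm : 1 ≤ m) (hn : 1 ≤ n)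
    (h1 : q ^ 2 ≤ x ^ 2 * (n / ρ ^ 2 - m / (1 - ρ) ^ 2))
    (h2 : x ^ 2 * (n / ρ ^ 2 - m / (1 - ρ) ^ 2) ≤ 2 * q ^ 2)
    (h3 : 2 * x ^ 3 * (m / (1 - ρ) ^ 3 + n / ρ ^ 3) ≤ K) :
    (stationaryMeasure ρ).real {ω | verMax ω m n ≤ horMax ω m n} ≤ 3 / 8 := by
  have ht0 : 0 < t := by rw [ht]; positivity
  have hq1 : 1 ≤ q := by rw [hq]; linarith
  have hq0 : 0 < q := by linarith
  have hα : 0 < 1 - ρ := by linarith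
  set d : ℝ := n / ρ ^ 2 - m / (1 - ρ) ^ 2 with hd
  set Q : ℝ := m / (1 - ρ) ^ 3 + n / ρ ^ 3 with hQ
  have hQ0 : 0 ≤ Q := by positivity
  have hxq : 0 < x / q := by positivity
  have hxqx : x / q ≤ x := div_le_self hx.le hq1
  -- With a₀ = x/q the quadratic terms are at most 1, so `t` can be fixed first; with a = x the gain
  -- x²d/2 ≥ q²/2 beats the loss qt.
  have key := measureReal_verMax_le_horMax_le hρ₀ hρ₁ hm hn hxq hxqx hxρ hxρ' ht0 hd hQ
  have e1 : (x / q) ^ 2 * d ≤ 2 := by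
    rw [div_pow, div_mul_eq_mul_div, div_le_iff₀ (by positivity)]
    linarith
  have e1' : 0 ≤ (x / q) ^ 2 * d := by
    rw [div_pow, div_mul_eq_mul_div]
    have : 0 ≤ x ^ 2 * d := le_trans (by positivity) h1
    positivity
  have e2 : 2 * (x / q) ^ 3 * Q ≤ K := by
    refine le_trans ?_ h3
    gcongr
  have e3 : x / (x / q) = q := by field_simp
  rw [e3] at key
  refine key.trans ?_
  have b1 : Real.exp (-((x / q) ^ 2 * d / 2) + 2 * (x / q) ^ 3 * Q) ≤ Real.exp (1 + K) :=
    Real.exp_le_exp.2 (by linarith)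
  have b2 : Real.exp ((x / q) ^ 2 * d / 2 + 2 * (x / q) ^ 3 * Q) ≤ Real.exp (1 + K) :=
    Real.exp_le_exp.2 (by linarith)
  have b3 : Real.exp (q * t + (-(x ^ 2 * d / 2) + 2 * x ^ 3 * Q)) ≤ 1 / 4 := by
    have h : q * t + (-(x ^ 2 * d / 2) + 2 * x ^ 3 * Q) ≤ -2 := by
      have h4 : q * t = q ^ 2 / 2 - q * (K + 2) := by rw [hq]; ring
      have h5 := mul_le_mul_of_nonneg_right hq1 (by linarith : 0 ≤ K + 2)
      linarith
    refine (Real.exp_le_exp.2 h).trans ?_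
    rw [Real.exp_neg, one_div]
    refine inv_anti₀ (by norm_num) ?_
    have h5 : 2 ≤ Real.exp 1 := by linarith [Real.add_one_le_exp (1 : ℝ)]
    have h6 : Real.exp 2 = Real.exp 1 * Real.exp 1 := by rw [← Real.exp_add]; norm_num
    have h7 := mul_le_mul h5 h5 (by norm_num) (by linarith)
    linarith
  have b4 : (Real.exp (-((x / q) ^ 2 * d / 2) + 2 * (x / q) ^ 3 * Q)
      + Real.exp ((x / q) ^ 2 * d / 2 + 2 * (x / q) ^ 3 * Q)) / t ≤ 1 / 8 := by
    rw [div_le_iff₀ ht0]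
    linarith
  linarith

lemma measureReal_horMax_le_verMax_le_three_eighths {ρ : ℝ} (hρ₀ : 0 < ρ) (hρ₁ : ρ < 1)
    {K q t x : ℝ} (hK : 0 ≤ K) (ht : t = 16 * Real.exp (1 + K)) (hq : q = 2 * t + 2 * (K + 2))
    (hx : 0 < x) (hxρ : x ≤ ρ / 2) (hxρ' : x ≤ (1 - ρ) / 2) {m n : ℕ} (hm : 1 ≤ m) (hn : 1 ≤ n)
    (h1 : q ^ 2 ≤ x ^ 2 * (m / (1 - ρ) ^ 2 - n / ρ ^ 2))
    (h2 : x ^ 2 * (m / (1 - ρ) ^ 2 - n / ρ ^ 2) ≤ 2 * q ^ 2)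
    (h3 : 2 * x ^ 3 * (m / (1 - ρ) ^ 3 + n / ρ ^ 3) ≤ K) :
    (stationaryMeasure ρ).real {ω | horMax ω m n ≤ verMax ω m n} ≤ 3 / 8 := by
  have e : 1 - (1 - ρ) = ρ := by ring
  have h := measureReal_verMax_le_horMax_le_three_eighths (ρ := 1 - ρ) (by linarith)
    (by linarith) hK ht hq hx hxρ' (by rwa [e]) hn hm (by rwa [e]) (by rwa [e])
    (by rw [e]; linarith)
  rw [← map_comp_swap_stationaryMeasure hρ₀ hρ₁, map_measureReal_apply measurable_comp_swap
    (measurableSet_le (measurable_verMax n m) (measurable_horMax n m))] at h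
  exact h

/-- A horizontal start with exit beyond `L` persists after `L` column shifts, where the end point is
`(m, n)`; the shifts preserve the measure. -/
lemma measureReal_verMax_le_horMax_le_add {ρ : ℝ} (hρ₀ : 0 < ρ) (hρ₁ : ρ < 1) {m n : ℕ} (L : ℕ)
    (hm : 1 ≤ m) (hn : 1 ≤ n) :
    (stationaryMeasure ρ).real {ω | verMax ω (m + L) n ≤ horMax ω (m + L) n}
      ≤ (stationaryMeasure ρ).real {ω | 0 < exitTime ω (m + L, n) ∧ exitTime ω (m + L, n) ≤ L}
        + (stationaryMeasure ρ).real {ω | verMax ω m n ≤ horMax ω m n} := by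
  have := isProbabilityMeasure_stationaryMeasure hρ₀ hρ₁
  have hT := (measurePreserving_columnShift hρ₀ hρ₁).iterate L
  have hms : MeasurableSet {ω : ℕ × ℕ → ℝ | verMax ω m n ≤ horMax ω m n} :=
    measurableSet_le (measurable_verMax m n) (measurable_horMax m n)
  rw [← hT.measureReal_preimage hms.nullMeasurableSet]
  refine (measureReal_mono ?_).trans (measureReal_union_le _ _)
  intro ω hω
  obtain ⟨k, h1, h2, h3, h4⟩ := exitTime_spec ω (by omega) hn hω
  by_cases hk : k ≤ L
  · left
    exact ⟨by rw [h3]; omega, by rw [h3]; omega⟩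
  · right
    have := verMax_le_horMax_iterate_columnShift ω L hn (not_le.1 hk) h2
      (by rw [h4, max_eq_left hω])
    rwa [Nat.add_sub_cancel] at this

/-- Telescoping over the end points `(m + j L, n)`, `j = 1, …, J`. -/
lemma measureReal_verMax_le_horMax_telescope {ρ : ℝ} (hρ₀ : 0 < ρ) (hρ₁ : ρ < 1) {m n : ℕ}
    (L J : ℕ) (hm : 1 ≤ m) (hn : 1 ≤ n) (E : Set (ℕ × ℕ → ℝ))
    (hE : ∀ i ω, 1 ≤ i → 0 < exitTime ω (i, n) → exitTime ω (i, n) ≤ L → ω ∈ E) :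
    (stationaryMeasure ρ).real {ω | verMax ω (m + J * L) n ≤ horMax ω (m + J * L) n}
      ≤ J * (stationaryMeasure ρ).real E
        + (stationaryMeasure ρ).real {ω | verMax ω m n ≤ horMax ω m n} := by
  have := isProbabilityMeasure_stationaryMeasure hρ₀ hρ₁
  induction J with
  | zero => simp
  | succ J ih =>
    have h := measureReal_verMax_le_horMax_le_add hρ₀ hρ₁ (m := m + J * L) L (by omega) hn
    have hle : (stationaryMeasure ρ).real {ω | 0 < exitTime ω (m + J * L + L, n) ∧
        exitTime ω (m + J * L + L, n) ≤ L} ≤ (stationaryMeasure ρ).real E :=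
      measureReal_mono fun ω hω => hE _ ω (by omega) hω.1 hω.2
    rw [show m + (J + 1) * L = m + J * L + L by ring]
    push_cast
    linarith

end Estimates

/-! ### Choice of the end points and conclusion. -/

set_option maxHeartbeats 1000000 in
/-- The choice of the end points `(m + j L, n)`, `0 ≤ j ≤ J`, at the scale `N = y ^ 3`. -/
lemma exists_endPoints {α ρ A K y δ : ℝ} (hα₀ : 0 < α) (hα₁ : α ^ 2 ≤ 1) (hρ₀ : 0 < ρ)
    (hρ2 : ρ ^ 2 ≤ 1) (hA1 : 1 ≤ A) (hK : K = 6 / α ^ 3 + 6 / ρ ^ 3)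
    (hyy : 2 * A + 2 / ρ + 2 / α + 1 / ρ ^ 2 + 1 / α ^ 2 ≤ y) (hδ1 : 1 ≤ δ * y ^ 2)
    (hδ₀ : δ ≤ α ^ 2 * A) :
    ∃ n m L J : ℕ, 1 ≤ n ∧ 1 ≤ m ∧ y ^ 3 * ρ ^ 2 < n ∧ L ≤ δ * y ^ 2 ∧ J * δ ≤ 8 * α ^ 2 * A ∧
      (A ≤ (1 / y) ^ 2 * (n / ρ ^ 2 - m / α ^ 2) ∧
        (1 / y) ^ 2 * (n / ρ ^ 2 - m / α ^ 2) ≤ 2 * A ∧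
        2 * (1 / y) ^ 3 * (m / α ^ 3 + n / ρ ^ 3) ≤ K) ∧
      A ≤ (1 / y) ^ 2 * ((m + J * L : ℕ) / α ^ 2 - n / ρ ^ 2) ∧
        (1 / y) ^ 2 * ((m + J * L : ℕ) / α ^ 2 - n / ρ ^ 2) ≤ 2 * A ∧
        2 * (1 / y) ^ 3 * ((m + J * L : ℕ) / α ^ 3 + n / ρ ^ 3) ≤ K := by
  have p1 : 0 < 2 / ρ := by positivity
  have p2 : 0 < 2 / α := by positivity
  have p3 : 0 < 1 / ρ ^ 2 := by positivity
  have p4 : 0 < 1 / α ^ 2 := by positivity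
  have hA0 : 0 < A := by linarith
  have hy0 : 0 < y := by linarith
  have hy1 : 1 ≤ y := by linarith
  have hyle2 : y ≤ y ^ 2 := le_self_pow₀ hy1 (by norm_num)
  have hyle3 : y ≤ y ^ 3 := le_self_pow₀ hy1 (by norm_num)
  have hAy3 : 2 * (A * y ^ 2) ≤ y ^ 3 := by
    have : 2 * A ≤ y := by linarith
    have h := mul_le_mul_of_nonneg_right this (sq_nonneg y)
    linarith
  -- the ordinate of the end points
  obtain ⟨n, hn⟩ : ∃ n : ℕ, n = ⌊2 * y ^ 3 * ρ ^ 2⌋₊ := ⟨_, rfl⟩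
  have hAy : y ^ 2 ≤ A * y ^ 2 := le_mul_of_one_le_left (sq_nonneg y) hA1
  have hn1 : (n : ℝ) ≤ 2 * y ^ 3 * ρ ^ 2 := hn ▸ Nat.floor_le (by positivity)
  have hn2 : 2 * y ^ 3 * ρ ^ 2 < n + 1 := hn ▸ Nat.lt_floor_add_one _
  -- The factor 2 in `n` leaves room for the rounding, so `n` exceeds the height y³ρ² of the box.
  have hy3ρ : 1 < y ^ 3 * ρ ^ 2 := by
    have : 1 / ρ ^ 2 < y ^ 3 := by linarith
    rwa [div_lt_iff₀ (by positivity)] at this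
  have hnpos : 1 ≤ n := by
    have : (0 : ℝ) < n := by linarith
    exact_mod_cast this
  obtain ⟨v, hv⟩ : ∃ v : ℝ, v = n / ρ ^ 2 := ⟨_, rfl⟩
  have hv1 : v ≤ 2 * y ^ 3 := by rw [hv, div_le_iff₀ (by positivity)]; exact hn1
  have hv2 : 2 * y ^ 3 - 1 / ρ ^ 2 < v := by
    rw [hv, sub_lt_iff_lt_add, ← add_div, lt_div_iff₀ (by positivity)]
    exact hn2
  -- the abscissa of the first end point
  have hm0' : 1 ≤ α ^ 2 * (v - A * y ^ 2) := by
    have : 1 / α ^ 2 ≤ v - A * y ^ 2 := by linarith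
    rw [div_le_iff₀ (by positivity)] at this
    linarith
  obtain ⟨m, hm⟩ : ∃ m : ℕ, m = ⌊α ^ 2 * (v - A * y ^ 2)⌋₊ := ⟨_, rfl⟩
  have hm1 : (m : ℝ) ≤ α ^ 2 * (v - A * y ^ 2) := hm ▸ Nat.floor_le (by linarith)
  have hm2 : α ^ 2 * (v - A * y ^ 2) < m + 1 := hm ▸ Nat.lt_floor_add_one _
  have hmpos : 1 ≤ m := hm ▸ Nat.one_le_floor_iff _ |>.2 hm0'
  obtain ⟨d, hd⟩ : ∃ d : ℝ, d = v - m / α ^ 2 := ⟨_, rfl⟩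
  have hd1 : A * y ^ 2 ≤ d := by
    have : (m : ℝ) / α ^ 2 ≤ v - A * y ^ 2 := by
      rw [div_le_iff₀ (by positivity)]; linarith
    linarith
  have hd2 : d ≤ 2 * (A * y ^ 2) := by
    have h1 : v - A * y ^ 2 ≤ (m : ℝ) / α ^ 2 + 1 / α ^ 2 := by
      rw [← add_div, le_div_iff₀ (by positivity)]; linarith
    have h2 : 1 / α ^ 2 ≤ A * y ^ 2 := by linarith
    linarith
  -- the spacing and the number of the end points
  obtain ⟨L, hL⟩ : ∃ L : ℕ, L = ⌊δ * y ^ 2⌋₊ := ⟨_, rfl⟩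
  have hL1 : (L : ℝ) ≤ δ * y ^ 2 := hL ▸ Nat.floor_le (by linarith)
  have hL2 : δ * y ^ 2 < L + 1 := hL ▸ Nat.lt_floor_add_one _
  have hLpos : 1 ≤ L := hL ▸ Nat.one_le_floor_iff _ |>.2 hδ1
  have hLpos' : (1 : ℝ) ≤ L := by exact_mod_cast hLpos
  have hL3 : (L : ℝ) ≤ α ^ 2 * (A * y ^ 2) := by
    refine hL1.trans ?_
    rw [← mul_assoc]
    exact mul_le_mul_of_nonneg_right hδ₀ (sq_nonneg y)
  -- The displacement that takes the deviation from d on the left to Ay² on the right. Rounding up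
  -- to a multiple of `L` overshoots by at most `L`, which `hL3` makes harmless; this is where δ ≤
  -- δ₀ enters.
  obtain ⟨X, hX⟩ : ∃ X : ℝ, X = α ^ 2 * (A * y ^ 2 + d) := ⟨_, rfl⟩
  have hX0 : 0 ≤ X := by rw [hX]; exact mul_nonneg (sq_nonneg α) (by linarith)
  obtain ⟨J, hJ⟩ : ∃ J : ℕ, J = ⌈X / L⌉₊ := ⟨_, rfl⟩
  have hJ1 : X ≤ J * L := by
    rw [← div_le_iff₀ (by linarith)]; exact hJ ▸ Nat.le_ceil _
  have hJ2 : J * L < X + L := by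
    have h : (J : ℝ) < X / L + 1 := hJ ▸ Nat.ceil_lt_add_one (by positivity)
    have h' := mul_lt_mul_of_pos_right h (by linarith : (0 : ℝ) < L)
    rwa [add_mul, one_mul, div_mul_cancel₀ _ (by linarith)] at h'
  obtain ⟨d', hd'⟩ : ∃ d' : ℝ, d' = ((m + J * L : ℕ) : ℝ) / α ^ 2 - v := ⟨_, rfl⟩
  have hd'eq : d' = (J * L : ℝ) / α ^ 2 - d := by
    rw [hd', hd]; push_cast; ring
  have hd'1 : A * y ^ 2 ≤ d' := by
    have : A * y ^ 2 + d ≤ (J * L : ℝ) / α ^ 2 := by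
      rw [le_div_iff₀ (by positivity)]; linarith
    linarith
  have hd'2 : d' ≤ 2 * (A * y ^ 2) := by
    have : (J * L : ℝ) / α ^ 2 ≤ 2 * (A * y ^ 2) + d := by
      rw [div_le_iff₀ (by positivity)]; linarith
    linarith
  have hy2 : ∀ c : ℝ, (1 / y) ^ 2 * c = c / y ^ 2 := fun c => by ring
  have hlow : ∀ c, A * y ^ 2 ≤ c → A ≤ (1 / y) ^ 2 * c := fun c hc => by
    rw [hy2, le_div_iff₀ (by positivity)]; exact hc
  have hupp : ∀ c, c ≤ 2 * (A * y ^ 2) → (1 / y) ^ 2 * c ≤ 2 * A := fun c hc => by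
    rw [hy2, div_le_iff₀ (by positivity)]; linarith
  have hcub : ∀ i : ℕ, (i : ℝ) ≤ α ^ 2 * (v + 2 * (A * y ^ 2)) →
      2 * (1 / y) ^ 3 * (i / α ^ 3 + n / ρ ^ 3) ≤ K := fun i hi => by
    have h1 : (i : ℝ) ≤ 3 * y ^ 3 := by
      refine hi.trans ?_
      have : 0 ≤ v + 2 * (A * y ^ 2) := by
        have : 0 ≤ v := by rw [hv]; positivity
        positivity
      have := mul_le_mul_of_nonneg_right hα₁ this
      linarith
    have h2 : (n : ℝ) ≤ 3 * y ^ 3 := by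
      have := mul_le_mul_of_nonneg_left hρ2 (by positivity : 0 ≤ 2 * y ^ 3)
      linarith
    calc 2 * (1 / y) ^ 3 * (i / α ^ 3 + n / ρ ^ 3)
        ≤ 2 * (1 / y) ^ 3 * (3 * y ^ 3 / α ^ 3 + 3 * y ^ 3 / ρ ^ 3) := by gcongr
      _ = K := by rw [hK]; field_simp; ring
  have hJδ : J * δ ≤ 8 * α ^ 2 * A := by
    have h1 : (J : ℝ) * L ≤ 4 * (α ^ 2 * (A * y ^ 2)) := by
      have : X ≤ α ^ 2 * (3 * (A * y ^ 2)) := by rw [hX]; gcongr; linarith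
      linarith
    have h2 : (J : ℝ) * (δ * y ^ 2) ≤ J * (2 * L) :=
        mul_le_mul_of_nonneg_left (by linarith) (Nat.cast_nonneg J)
    have h3 : (J * δ) * y ^ 2 ≤ (8 * α ^ 2 * A) * y ^ 2 := by linarith
    exact le_of_mul_le_mul_right h3 (by positivity)
  refine ⟨n, m, L, J, hnpos, hmpos, by linarith, hL1, hJδ, ?_, ?_⟩
  · rw [← hv, ← hd]
    exact ⟨hlow d hd1, hupp d hd2, hcub m (hm1.trans (by gcongr; linarith))⟩
  · rw [← hv, ← hd']
    refine ⟨hlow d' hd'1, hupp d' hd'2, hcub _ ?_⟩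
    have : ((m + J * L : ℕ) : ℝ) / α ^ 2 ≤ v + 2 * (A * y ^ 2) := by linarith
    rw [div_le_iff₀ (by positivity)] at this
    linarith

theorem mainTheorem6 (ρ : ℝ) (hρ₀ : 0 < ρ) (hρ₁ : ρ < 1) :
    ∃ δ₀ C N₀ : ℝ, 0 < δ₀ ∧ 0 < C ∧ 0 < N₀ ∧
      ∀ N δ : ℝ, N₀ ≤ N → N ^ (-(2 / 3) : ℝ) ≤ δ → δ ≤ δ₀ →
        C * δ ≤ (stationaryMeasure ρ).real
          {ω | ∃ z : ℕ × ℕ, 0 < z.1 ∧ 0 < z.2 ∧ z ∉ Set.Icc (0, 0) (charPoint ρ N) ∧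
            |(exitTime ω z : ℝ)| ≤ δ * N ^ (2 / 3 : ℝ)} := by
  have := isProbabilityMeasure_stationaryMeasure hρ₀ hρ₁
  set α := 1 - ρ with hα
  have hα₀ : 0 < α := by linarith
  have hα₁ : α ^ 2 ≤ 1 := pow_le_one₀ hα₀.le (by linarith)
  have hρ2 : ρ ^ 2 ≤ 1 := pow_le_one₀ hρ₀.le hρ₁.le
  obtain ⟨K, hK⟩ : ∃ K : ℝ, K = 6 / α ^ 3 + 6 / ρ ^ 3 := ⟨_, rfl⟩
  have hK0 : 0 ≤ K := by rw [hK]; positivity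
  obtain ⟨t, ht⟩ : ∃ t : ℝ, t = 16 * Real.exp (1 + K) := ⟨_, rfl⟩
  obtain ⟨q, hq⟩ : ∃ q : ℝ, q = 2 * t + 2 * (K + 2) := ⟨_, rfl⟩
  have ht0 : 0 < t := by rw [ht]; positivity
  obtain ⟨A, hA⟩ : ∃ A : ℝ, A = q ^ 2 := ⟨_, rfl⟩
  have hA1 : 1 ≤ A := by
    rw [hA]
    exact one_le_pow₀ (by linarith)
  have hA0 : 0 < A := by linarith
  obtain ⟨y₀, hy₀⟩ : ∃ y₀ : ℝ, y₀ = 2 * A + 2 / ρ + 2 / α + 1 / ρ ^ 2 + 1 / α ^ 2 := ⟨_, rfl⟩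
  have p1 : 0 < 2 / ρ := by positivity
  have p2 : 0 < 2 / α := by positivity
  have p3 : 0 < 1 / ρ ^ 2 := by positivity
  have p4 : 0 < 1 / α ^ 2 := by positivity
  have hy₀0 : 0 < y₀ := by rw [hy₀]; positivity
  -- 32 = 4 · 8: the telescoped probability gap is 1/4, and Jδ ≤ 8α²A.
  refine ⟨α ^ 2 * A, 1 / (32 * α ^ 2 * A), y₀ ^ 3, by positivity, by positivity, by positivity, ?_⟩
  intro N δ hN hδ hδ₀
  have hN0 : 0 < N := lt_of_lt_of_le (by positivity) hN
  obtain ⟨y, hy⟩ : ∃ y : ℝ, y = N ^ (1 / 3 : ℝ) := ⟨_, rfl⟩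
  have hyy : y₀ ≤ y := by
    rw [hy, one_div]
    refine (Real.le_rpow_inv_iff_of_pos hy₀0.le hN0.le (by norm_num)).2 ?_
    exact_mod_cast hN
  have hy0 : 0 < y := hy₀0.trans_le hyy
  have hN3 : N = y ^ 3 := by
    rw [hy, ← Real.rpow_natCast, ← Real.rpow_mul hN0.le]; norm_num
  have hN23 : N ^ (2 / 3 : ℝ) = y ^ 2 := by
    rw [hy, ← Real.rpow_natCast, ← Real.rpow_mul hN0.le]; norm_num
  rw [Real.rpow_neg hN0.le, hN23] at hδ
  rw [hN23]
  have hy1 : 1 ≤ y := by linarith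
  have hδ1 : 1 ≤ δ * y ^ 2 := by
    rw [inv_le_iff_one_le_mul₀ (by positivity)] at hδ
    linarith
  obtain ⟨n, m, L, J, hnpos, hmpos, hn, hL1, hJδ, ⟨hl1, hl2, hl3⟩, hr1, hr2, hr3⟩ :=
    exists_endPoints hα₀ hα₁ hρ₀ hρ2 hA1 hK (hy₀ ▸ hyy) hδ1 hδ₀
  have hx : 0 < 1 / y := by positivity
  have hxρ : 1 / y ≤ ρ / 2 := by
    rw [div_le_iff₀ hy0]
    have : 2 / ρ ≤ y := by linarith
    rw [div_le_iff₀ hρ₀] at this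
    linarith
  have hxα : 1 / y ≤ α / 2 := by
    rw [div_le_iff₀ hy0]
    have : 2 / α ≤ y := by linarith
    rw [div_le_iff₀ hα₀] at this
    linarith
  have hleft := measureReal_verMax_le_horMax_le_three_eighths hρ₀ hρ₁ hK0 ht hq hx hxρ hxα hmpos
    hnpos (hA ▸ hl1) (hA ▸ hl2) hl3
  have hright := measureReal_horMax_le_verMax_le_three_eighths hρ₀ hρ₁ hK0 ht hq hx hxρ hxα
    (m := m + J * L) (by omega) hnpos (hA ▸ hr1) (hA ▸ hr2) hr3
  -- Ties belong to both events, so almost sure uniqueness is not needed.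
  have hone : 1 ≤ (stationaryMeasure ρ).real {ω | verMax ω (m + J * L) n ≤ horMax ω (m + J * L) n}
      + (stationaryMeasure ρ).real {ω | horMax ω (m + J * L) n ≤ verMax ω (m + J * L) n} := by
    refine le_trans (le_of_eq ?_) (measureReal_union_le _ _)
    rw [← probReal_univ (μ := stationaryMeasure ρ)]
    congr 1
    ext ω
    simpa using le_total _ _
  set E := {ω : ℕ × ℕ → ℝ | ∃ z : ℕ × ℕ, 0 < z.1 ∧ 0 < z.2 ∧
    z ∉ Set.Icc (0, 0) (charPoint ρ N) ∧ |(exitTime ω z : ℝ)| ≤ δ * y ^ 2} with hE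
  have htel := measureReal_verMax_le_horMax_telescope hρ₀ hρ₁ L J hmpos hnpos E (by
    intro i ω hi h1 h2
    refine ⟨(i, n), hi, hnpos, fun hz => ?_, ?_⟩
    · have h3 : n ≤ ⌊N * ρ ^ 2⌋₊ := hz.2.2
      have h4 : (n : ℝ) ≤ N * ρ ^ 2 := (Nat.le_floor_iff (by positivity)).1 h3
      rw [hN3] at h4
      linarith
    · have h1' : (0 : ℝ) < exitTime ω (i, n) := by exact_mod_cast h1
      have h2' : (exitTime ω (i, n) : ℝ) ≤ L := by exact_mod_cast h2
      rw [abs_of_pos h1']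
      exact h2'.trans hL1)
  -- 1 - 3/8 - 3/8 = 1/4.
  have hquarter : 1 / 4 ≤ J * (stationaryMeasure ρ).real E := by linarith
  have hδpos : 0 < δ := by
    by_contra h
    have : δ * y ^ 2 ≤ 0 := mul_nonpos_of_nonpos_of_nonneg (not_lt.1 h) (sq_nonneg y)
    linarith
  have hp : 0 ≤ (stationaryMeasure ρ).real E := measureReal_nonneg
  rw [div_mul_eq_mul_div, one_mul, div_le_iff₀ (by positivity)]
  have h1 := mul_le_mul_of_nonneg_left hquarter hδpos.le
  have h2 := mul_le_mul_of_nonneg_right hJδ hp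
  linarith
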